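/- Let $S$ be a left cancellative monoid with identity $e$, and let $C^*_r(S)\subset B(\ell^2(S))$ be the C*-algebra generated by the isometries $\lambda_s\delta_t=\delta_{st}$, $s\in S$. **Left inverse hull.** Let $I_\ell(S)$ be the inverse semigroup of partial bijections of $S$ generated by the left translations $S\to sS$, $t\mapsto st$ ($s\in S$); an element $s\in S$ is identified with the corresponding left translation. Let $E(S)$ be the semigroup of idempotents of $I_\ell(S)$, let $\mathcal J(S)$ be the collection of domains of elements of $E(S)$ (the constructible right ideals of $S$), and for $X\in\mathcal J(S)$ let $p_X\in E(S)$ be the identity map of $X$. **Strong C*-regularity.** $S$ is called strongly C*-regular if, whenever $h_1,\dots,h_n\in I_\ell(S)$ and $X,X_1,\dots,X_m\in\mathcal J(S)$ (with $m\ge 0$) satisfy $$\emptyset\neq X\setminus\bigcup_{i=1}^m X_i\subset\bigcup_{k=1}^n\{s\in S: h_k s=s\},$$ there are $Y_1,\dots,Y_l\in\mathcal J(S)$ and indices $1\le k_j\le n$ ($1\le j\le l$) such that $$X\setminus\bigcup_{i=1}^m X_i\subset\bigcup_{j=1}^l Y_j\quad\text{and}\quad h_{k_j}p_{Y_j}=p_{Y_j}\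 \text{ for all } 1\le j\le l .$$ **The groupoid.** Let $\widehat{E(S)}$ be the space of nonzero semigroup homomorphisms $\chi\colon E(S)\to\{0,1\}$ with the topology of pointwise convergence. The Paterson groupoid $\mathcal G(I_\ell(S))$ has unit space $\widehat{E(S)}$; its arrows are the classes $[g,\chi]$ of pairs $(g,\chi)\in I_\ell(S)\times\widehat{E(S)}$ with $\chi(g^{-1}g)=1$, where $[g_1,\chi_1]=[g_2,\chi_2]$ iff $\chi_1=\chi_2$ and $g_1p=g_2p$ for some $p\in E(S)$ with $\chi_1(p)=1$. The source of $[g,\chi]$ is $\chi$, its range is $\chi(g^{-1}\cdot g)$, the product is $[g,\chi][h,\psi]=[gh,\psi]$ for $\chi=\psi(h^{-1}\cdot h)$, and a basis of the topology is given by the sets $\{[g,\chi]:\chi\in U\}$ with $g\in I_\ell(S)$ and $U$ an open subset of $\{\chi:\chi(g^{-1}g)=1\}$. Let $\chi_e\in\widehat{E(S)}$ be defined by $\chi_e(p_X)=1$ iff $e\in X$, let $\Omega(S)$ be the closure of the orbit of $\chi_e$ in $\widehat{E(S)}$, and let $\mathcal G_P(S)$ be the reduction of $\mathcal G(I_\ell(S))$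 to $\Omega(S)$, with the subspace topology. **Reduced groupoid C*-algebra.** For an étale, not necessarily Hausdorff, groupoid $\mathcal G$ with source map $s$ and range map $r$, put $\mathcal G_x=s^{-1}(x)$ and $\mathcal G^x=r^{-1}(x)$, and let $C_c(\mathcal G)$ be the linear span of the functions on $\mathcal G$ that are continuous with compact support on some open Hausdorff subset and are extended by zero. For every unit $x$ and $f\in C_c(\mathcal G)$ define $\rho_x(f)\in B(\ell^2(\mathcal G_x))$ by $(\rho_x(f)\xi)(g)=\sum_{h\in\mathcal G^{r(g)}}f(h)\xi(h^{-1}g)$. Let $C^*_r(\mathcal G)$ be the completion of $C_c(\mathcal G)$, with the convolution product and the involution $f^*(g)=\overline{f(g^{-1})}$, in the norm $\|f\|_r=\sup_x\|\rho_x(f)\|$; each $\rho_x$ extends to $C^*_r(\mathcal G)$. **Proposition.** Assume that $S$ is strongly C*-regular. Identify $S$ with $\mathcal G_P(S)_{\chi_e}$ by the bijection $s\mapsto[s,\chi_e]$, and hence $\ell^2(\mathcal G_P(S)_{\chi_e})$ with $\ell^2(S)$. Then the representation $\rho_{\chi_e}$ of $C^*_r(\mathcal G_P(S))$ is a $*$-isomorphism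 of $C^*_r(\mathcal G_P(S))$ onto $C^*_r(S)$; that is, there is a $*$-isomorphism $\Phi\colon C^*_r(\mathcal G_P(S))\to C^*_r(S)$ with $\Phi(a)=\rho_{\chi_e}(a)$ for all $a\in C^*_r(\mathcal G_P(S))$. -/

import Mathlib

open CategoryTheory Topology
open scoped ENNReal

noncomputable section

/-! ## Hilbert spaces `ℓ²(α)` -/

/-- The Hilbert space `ℓ²(α)`. -/
abbrev EllTwo (α : Type*) : Type _ := lp (fun _ : α => ℂ) 2

namespace EllTwo

/-- Weighted partial permutations are bounded operators. -/
theorem exists_weighted {α β : Type*} (φ : β → α) (w : β → ℂ) (C : ℝ) (hC : 0 ≤ C)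
    (hφ : Set.InjOn φ {b | w b ≠ 0}) (hw : ∀ b, ‖w b‖ ≤ C) :
    ∃ T : EllTwo α →L[ℂ] EllTwo β, ‖T‖ ≤ C ∧ ∀ ξ b, T ξ b = w b * ξ (φ b) := by
  classical
  have h2 : (0 : ℝ) < (2 : ℝ≥0∞).toReal := by norm_num
  have key : ∀ (ξ : EllTwo α) (s : Finset β),
      ∑ b ∈ s, ‖w b * ξ (φ b)‖ ^ (2 : ℝ≥0∞).toReal ≤ (C * ‖ξ‖) ^ (2 : ℝ≥0∞).toReal := by
    intro ξ s
    have hsub : (↑(s.filter fun b => w b ≠ 0) : Set β) ⊆ {b | w b ≠ 0} := by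
      intro b hb
      simpa using (Finset.mem_filter.1 hb).2
    calc ∑ b ∈ s, ‖w b * ξ (φ b)‖ ^ (2 : ℝ≥0∞).toReal
        = ∑ b ∈ s.filter (fun b => w b ≠ 0), ‖w b * ξ (φ b)‖ ^ (2 : ℝ≥0∞).toReal := by
          rw [Finset.sum_filter]
          refine Finset.sum_congr rfl fun b _ => ?_
          by_cases hb : w b = 0
          · simp [hb]
          · simp [hb]
      _ ≤ ∑ b ∈ s.filter (fun b => w b ≠ 0),
            C ^ (2 : ℝ≥0∞).toReal * ‖ξ (φ b)‖ ^ (2 : ℝ≥0∞).toReal := by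
          refine Finset.sum_le_sum fun b _ => ?_
          rw [norm_mul, Real.mul_rpow (norm_nonneg _) (norm_nonneg _)]
          gcongr
          exact hw b
      _ = C ^ (2 : ℝ≥0∞).toReal *
            ∑ a ∈ (s.filter (fun b => w b ≠ 0)).image φ, ‖ξ a‖ ^ (2 : ℝ≥0∞).toReal := by
          rw [Finset.sum_image (hφ.mono hsub), Finset.mul_sum]
      _ ≤ C ^ (2 : ℝ≥0∞).toReal * ‖ξ‖ ^ (2 : ℝ≥0∞).toReal := by
          gcongr
          exact lp.sum_rpow_le_norm_rpow h2 ξ _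
      _ = (C * ‖ξ‖) ^ (2 : ℝ≥0∞).toReal := by
          rw [Real.mul_rpow hC (norm_nonneg _)]
  let T₀ : EllTwo α →ₗ[ℂ] EllTwo β :=
    { toFun := fun ξ => ⟨fun b => w b * ξ (φ b), memℓp_gen' (key ξ)⟩
      map_add' := fun ξ η => lp.ext (funext fun b => mul_add _ _ _)
      map_smul' := fun c ξ => lp.ext (funext fun b => mul_left_comm _ _ _) }
  refine ⟨T₀.mkContinuous C fun ξ => ?_, LinearMap.mkContinuous_norm_le _ hC _, fun ξ b => rfl⟩
  exact lp.norm_le_of_forall_sum_le h2 (by positivity) (key ξ)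

/-- The unitary `ℓ²(α) ≅ ℓ²(β)` induced by a bijection `α ≃ β`. -/
def reindex {α β : Type*} (e : α ≃ β) : EllTwo α ≃ₗᵢ[ℂ] EllTwo β where
  toFun ξ := ⟨fun b => ξ (e.symm b), memℓp_gen (by
    have h := (lp.memℓp ξ).summable (by norm_num)
    exact (e.symm.summable_iff (f := fun i => ‖ξ i‖ ^ (2 : ℝ≥0∞).toReal)).2 h)⟩
  invFun ξ := ⟨fun a => ξ (e a), memℓp_gen (by
    have h := (lp.memℓp ξ).summable (by norm_num)
    exact (e.summable_iff (f := fun i => ‖ξ i‖ ^ (2 : ℝ≥0∞).toReal)).2 h)⟩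
  map_add' _ _ := rfl
  map_smul' _ _ := rfl
  left_inv ξ := lp.ext (funext fun a => congrArg ξ (e.symm_apply_apply a))
  right_inv ξ := lp.ext (funext fun a => congrArg ξ (e.apply_symm_apply a))
  norm_map' ξ := by
    rw [lp.norm_eq_tsum_rpow (by norm_num), lp.norm_eq_tsum_rpow (by norm_num)]
    congr 1
    exact e.symm.tsum_eq (fun i => ‖ξ i‖ ^ (2 : ℝ≥0∞).toReal)

end EllTwo

/-- The C*-algebra `∏_x B(H_x)` of bounded families of operators on Hilbert spaces, with the
supremum norm. -/
def BoundedFamilies {X : Type*} (H : X → Type*) [∀ x, NormedAddCommGroup (H x)]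
    [∀ x, InnerProductSpace ℂ (H x)] : Type _ :=
  lp (fun x => H x →L[ℂ] H x) ∞

namespace BoundedFamilies

variable {X : Type*} (H : X → Type*) [∀ x, NormedAddCommGroup (H x)]
  [∀ x, InnerProductSpace ℂ (H x)] [∀ x, CompleteSpace (H x)]

instance : NonUnitalCStarAlgebra (BoundedFamilies H) :=
  inferInstanceAs (NonUnitalCStarAlgebra (lp (fun x => H x →L[ℂ] H x) ∞))

variable {H}

/-- The bounded family with the given members. -/
def mk (T : ∀ x, H x →L[ℂ] H x) (hT : BddAbove (Set.range fun x => ‖T x‖)) : BoundedFamilies H :=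
  (⟨T, memℓp_infty hT⟩ : lp (fun x => H x →L[ℂ] H x) ∞)

/-- The evaluation at `x`. -/
def eval (x : X) : BoundedFamilies H →⋆ₙₐ[ℂ] (H x →L[ℂ] H x) where
  toFun a := (show lp (fun x => H x →L[ℂ] H x) ∞ from a) x
  map_smul' _ _ := rfl
  map_zero' := rfl
  map_add' _ _ := rfl
  map_mul' _ _ := rfl
  map_star' _ := rfl

theorem eval_mk (T : ∀ x, H x →L[ℂ] H x) (hT : BddAbove (Set.range fun x => ‖T x‖)) (x : X) :
    eval x (mk T hT) = T x := rfl

theorem norm_eq_iSup (a : BoundedFamilies H) : ‖a‖ = ⨆ x, ‖eval x a‖ := rfl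

end BoundedFamilies

/-! ## Reduced C*-algebras of étale groupoids

A groupoid is a category all of whose arrows are invertible; its unit space is the type `X` of
objects.  The composition `g ≫ h` is the product `hg` of the groupoid. -/

/-- The set of all arrows of a groupoid with unit space `X`. -/
@[ext] structure Arr (X : Type*) [Groupoid X] where
  /-- the source of the arrow -/
  src : X
  /-- the range of the arrow -/
  tgt : X
  /-- the arrow itself -/
  hom : src ⟶ tgt

/-- The fiber `𝒢_x = s⁻¹(x)`. -/
abbrev SourceFiber {X : Type*} [Groupoid X] (x : X) : Type _ := Σ y : X, (x ⟶ y)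

/-- The fiber `𝒢^y = r⁻¹(y)`. -/
abbrev RangeFiber {X : Type*} [Groupoid X] (y : X) : Type _ := Σ z : X, (z ⟶ y)

/-- An element of `𝒢^y` as an arrow. -/
def RangeFiber.toArr {X : Type*} [Groupoid X] {y : X} (h : RangeFiber y) : Arr X := ⟨h.1, y, h.2⟩

/-- The open bisections (open sets on which source and range are injective) cover the groupoid.
This holds in every étale groupoid, and makes the operators `ρ_x(f)` below bounded. -/
class HasOpenBisections (X : Type*) [Groupoid X] [TopologicalSpace (Arr X)] : Prop where
  exists_bisection : ∀ γ : Arr X, ∃ U : Set (Arr X), IsOpen U ∧ γ ∈ U ∧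
    Set.InjOn Arr.src U ∧ Set.InjOn Arr.tgt U

/-- The space `C_c(𝒢)` of a not necessarily Hausdorff groupoid: the span in the space of all
functions of the functions that are continuous and compactly supported on an open Hausdorff subset
`V`, extended by zero. -/
def Cc (X : Type*) [Groupoid X] [TopologicalSpace (Arr X)] : Submodule ℂ (Arr X → ℂ) :=
  Submodule.span ℂ {f | ∃ V : Set (Arr X), IsOpen V ∧ T2Space V ∧ ContinuousOn f V ∧
    ∃ K : Set (Arr X), K ⊆ V ∧ IsCompact K ∧ ∀ γ, γ ∉ K → f γ = 0}

section RegularRepresentations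

variable {X : Type*} [Groupoid X]

/-- The formula `(ρ_x(f)ξ)(g) = ∑_{h ∈ 𝒢^{r(g)}} f(h) ξ(h⁻¹g)` for `g ∈ 𝒢_x`. -/
def convApply (f : Arr X → ℂ) {x : X} (ξ : EllTwo (SourceFiber x)) (g : SourceFiber x) : ℂ :=
  ∑' h : RangeFiber g.1, f h.toArr * ξ ⟨h.1, g.2 ≫ Groupoid.inv h.2⟩

/-- Functions with finite supports on the fibers `𝒢^y` that act by bounded operators, with a bound
that is uniform in `x`. -/
def boundedConv (X : Type*) [Groupoid X] : Submodule ℂ (Arr X → ℂ) where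
  carrier := {f | (∀ y : X, {h : RangeFiber y | f h.toArr ≠ 0}.Finite) ∧
    ∃ C : ℝ, 0 ≤ C ∧ ∀ x : X, ∃ T : EllTwo (SourceFiber x) →L[ℂ] EllTwo (SourceFiber x),
      ‖T‖ ≤ C ∧ ∀ ξ g, T ξ g = convApply f ξ g}
  zero_mem' := by
    refine ⟨fun y => by simp, 0, le_rfl, fun x => ⟨0, by simp, fun ξ g => ?_⟩⟩
    simp [convApply]
  add_mem' := by
    rintro f₁ f₂ ⟨hf₁, C₁, hC₁, h₁⟩ ⟨hf₂, C₂, hC₂, h₂⟩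
    refine ⟨fun y => ((hf₁ y).union (hf₂ y)).subset ?_, C₁ + C₂, by positivity, fun x => ?_⟩
    · intro h hh
      by_contra hc
      simp only [Set.mem_union, Set.mem_ofPred_eq, not_or, not_not] at hc
      exact hh (by simp [hc.1, hc.2])
    · obtain ⟨T₁, hT₁, e₁⟩ := h₁ x
      obtain ⟨T₂, hT₂, e₂⟩ := h₂ x
      refine ⟨T₁ + T₂, (norm_add_le _ _).trans (add_le_add hT₁ hT₂), fun ξ g => ?_⟩
      have : (T₁ + T₂) ξ g = T₁ ξ g + T₂ ξ g := rfl
      rw [this, e₁, e₂, convApply, convApply, convApply, ← Summable.tsum_add]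
      · simp only [Pi.add_apply, add_mul]
      · refine summable_of_hasFiniteSupport ((hf₁ g.1).subset fun h hh => ?_)
        exact left_ne_zero_of_mul hh
      · refine summable_of_hasFiniteSupport ((hf₂ g.1).subset fun h hh => ?_)
        exact left_ne_zero_of_mul hh
  smul_mem' := by
    rintro c f ⟨hf, C, hC, h⟩
    refine ⟨fun y => (hf y).subset fun h hh => right_ne_zero_of_mul hh,
      ‖c‖ * C, by positivity, fun x => ?_⟩
    obtain ⟨T, hT, e⟩ := h x
    refine ⟨c • T, (norm_smul_le c T).trans (mul_le_mul_of_nonneg_left hT (norm_nonneg c)),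
      fun ξ g => ?_⟩
    have : (c • T) ξ g = c * T ξ g := rfl
    rw [this, e, convApply, convApply, ← tsum_mul_left]
    simp only [Pi.smul_apply, smul_eq_mul, mul_assoc]

theorem mem_boundedConv_of_bisection (f : Arr X → ℂ) (U : Set (Arr X))
    (hs : Set.InjOn Arr.src U) (hr : Set.InjOn Arr.tgt U) (hU : ∀ γ, γ ∉ U → f γ = 0)
    (C : ℝ) (hC : ∀ γ, ‖f γ‖ ≤ C) : f ∈ boundedConv X := by
  classical
  have hmem : ∀ γ, f γ ≠ 0 → γ ∈ U := fun γ h => by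
    by_contra hc
    exact h (hU γ hc)
  have huniq : ∀ (y : X) (h h' : RangeFiber y), f h.toArr ≠ 0 → f h'.toArr ≠ 0 → h = h' := by
    rintro y ⟨z, h⟩ ⟨z', h'⟩ hh hh'
    have := hr (hmem _ hh) (hmem _ hh') rfl
    simp only [RangeFiber.toArr, Arr.mk.injEq] at this
    obtain ⟨rfl, -, h3⟩ := this
    obtain rfl := eq_of_heq h3
    rfl
  refine ⟨fun y => Set.Subsingleton.finite fun h hh h' hh' => huniq y h h' hh hh',
    max C 0, le_max_right _ _, fun x => ?_⟩
  let pick : ∀ y : X, RangeFiber y := fun y =>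
    if hy : ∃ h : RangeFiber y, f h.toArr ≠ 0 then hy.choose else ⟨y, 𝟙 y⟩
  have hpick : ∀ (y : X) (h : RangeFiber y), f h.toArr ≠ 0 → h = pick y := by
    intro y h hh
    have hy : ∃ h : RangeFiber y, f h.toArr ≠ 0 := ⟨h, hh⟩
    have : pick y = hy.choose := dif_pos hy
    rw [this]
    exact huniq y _ _ hh hy.choose_spec
  obtain ⟨T, hT, e⟩ := EllTwo.exists_weighted (α := SourceFiber x) (β := SourceFiber x)
    (fun g => ⟨(pick g.1).1, g.2 ≫ Groupoid.inv (pick g.1).2⟩) (fun g => f (pick g.1).toArr)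
    (max C 0) (le_max_right _ _) (by
      rintro ⟨y, g⟩ hg ⟨y', g'⟩ hg' heq
      change f (pick y).toArr ≠ 0 at hg
      change f (pick y').toArr ≠ 0 at hg'
      change (⟨(pick y).1, g ≫ Groupoid.inv (pick y).2⟩ : SourceFiber x) =
        ⟨(pick y').1, g' ≫ Groupoid.inv (pick y').2⟩ at heq
      generalize hp : pick y = p at *
      generalize hp' : pick y' = p' at *
      clear hp hp'
      obtain ⟨z, h⟩ := p
      obtain ⟨z', h'⟩ := p'
      have h1 : z = z' := congrArg Sigma.fst heq
      have := hs (hmem _ hg) (hmem _ hg') h1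
      simp only [RangeFiber.toArr, Arr.mk.injEq] at this
      obtain ⟨rfl, rfl, h3⟩ := this
      obtain rfl := eq_of_heq h3
      simp only [Sigma.mk.injEq, heq_eq_eq, true_and] at heq
      have := (cancel_mono (Groupoid.inv h)).1 heq
      rw [this])
    (fun g => (hC _).trans (le_max_left _ _))
  refine ⟨T, hT, fun ξ g => ?_⟩
  rw [e, convApply, tsum_eq_single (pick g.1)]
  intro h hh
  by_cases h0 : f h.toArr = 0
  · rw [h0, zero_mul]
  · exact absurd (hpick _ _ h0) hh

theorem mem_boundedConv_of_finite (t : Set (Set (Arr X))) (ht : t.Finite)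
    (hb : ∀ U ∈ t, Set.InjOn Arr.src U ∧ Set.InjOn Arr.tgt U) (C : ℝ) :
    ∀ f : Arr X → ℂ, (∀ γ, γ ∉ ⋃₀ t → f γ = 0) → (∀ γ, ‖f γ‖ ≤ C) → f ∈ boundedConv X := by
  classical
  induction t, ht using Set.Finite.induction_on with
  | empty =>
    intro f hf _
    have : f = 0 := funext fun γ => hf γ (by simp)
    rw [this]
    exact zero_mem _
  | @insert U t _ _ ih =>
    intro f hf hC
    have hsum : f = U.indicator f + Uᶜ.indicator f := (Set.indicator_self_add_compl U f).symm
    rw [hsum]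
    refine add_mem ?_ ?_
    · refine mem_boundedConv_of_bisection _ U (hb U (by simp)).1 (hb U (by simp)).2
        (fun γ hγ => by simp [hγ]) C fun γ => ?_
      exact (norm_indicator_le_norm_self _ _).trans (hC γ)
    · refine ih (fun V hV => hb V (by simp [hV])) _ (fun γ hγ => ?_) fun γ => ?_
      · by_cases hU : γ ∈ U
        · simp [hU]
        · simp only [Set.mem_compl_iff, hU, not_false_eq_true, Set.indicator_of_mem]
          refine hf γ ?_
          rw [Set.sUnion_insert]
          simp only [Set.mem_union, not_or]
          exact ⟨hU, hγ⟩
      · exact (norm_indicator_le_norm_self _ _).trans (hC γ)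

theorem Cc_le_boundedConv (X : Type*) [Groupoid X] [TopologicalSpace (Arr X)]
    [HasOpenBisections X] : Cc X ≤ boundedConv X := by
  refine Submodule.span_le.2 ?_
  rintro f ⟨V, -, -, hf, K, hKV, hK, h0⟩
  choose W hW hγW hs hr using HasOpenBisections.exists_bisection (X := X)
  obtain ⟨t, _, htK⟩ := hK.elim_nhds_subcover W
    (fun γ _ => (hW γ).mem_nhds (hγW γ))
  obtain ⟨C, hC⟩ := hK.exists_bound_of_continuousOn (hf.mono hKV)
  refine mem_boundedConv_of_finite (W '' (t : Set (Arr X))) (t.finite_toSet.image _)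
    ?_ (max C 0) f (fun γ hγ => h0 γ fun hc => hγ ?_) fun γ => ?_
  · rintro _ ⟨γ, -, rfl⟩
    exact ⟨hs γ, hr γ⟩
  · have := htK hc
    simp only [Set.mem_iUnion] at this
    obtain ⟨δ, hδ, h⟩ := this
    exact ⟨W δ, ⟨δ, hδ, rfl⟩, h⟩
  · by_cases hγ : γ ∈ K
    · exact (hC γ hγ).trans (le_max_left _ _)
    · simp [h0 γ hγ]

end RegularRepresentations

section ReducedCStar

variable {X : Type*} [Groupoid X] [TopologicalSpace (Arr X)] [HasOpenBisections X]

theorem exists_rho (x : X) (f : Cc X) :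
    ∃ T : EllTwo (SourceFiber x) →L[ℂ] EllTwo (SourceFiber x),
      ∀ ξ g, T ξ g = convApply (f : Arr X → ℂ) ξ g := by
  obtain ⟨-, C, -, h⟩ := Cc_le_boundedConv X f.2
  obtain ⟨T, -, e⟩ := h x
  exact ⟨T, e⟩

/-- The operator `ρ_x(f)` on `ℓ²(𝒢_x)`, for `f ∈ C_c(𝒢)`. -/
def rho (x : X) (f : Cc X) : EllTwo (SourceFiber x) →L[ℂ] EllTwo (SourceFiber x) :=
  (exists_rho x f).choose

theorem rho_apply (x : X) (f : Cc X) (ξ : EllTwo (SourceFiber x)) (g : SourceFiber x) :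
    rho x f ξ g = ∑' h : RangeFiber g.1,
      (f : Arr X → ℂ) ⟨h.1, g.1, h.2⟩ * ξ ⟨h.1, g.2 ≫ Groupoid.inv h.2⟩ :=
  (exists_rho x f).choose_spec ξ g

variable (X) in
/-- The C*-algebra `∏_x B(ℓ²(𝒢_x))`. -/
abbrev ProdB : Type _ := BoundedFamilies fun x : X => EllTwo (SourceFiber x)

/-- The family `(ρ_x(f))_x`. Its norm is the reduced norm `‖f‖_r = sup_x ‖ρ_x(f)‖`. -/
def regRep (f : Cc X) : ProdB X :=
  BoundedFamilies.mk (fun x => rho x f) <| by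
    obtain ⟨-, C, -, h⟩ := Cc_le_boundedConv X f.2
    refine ⟨C, ?_⟩
    rintro _ ⟨x, rfl⟩
    obtain ⟨T, hT, e⟩ := h x
    have : rho x f = T := ContinuousLinearMap.ext fun ξ => lp.ext <| funext fun g => by
      rw [e]
      exact rho_apply x f ξ g
    simpa only [this] using hT

theorem norm_regRep (f : Cc X) : ‖regRep f‖ = ⨆ x : X, ‖rho x f‖ := BoundedFamilies.norm_eq_iSup _

variable (X) in
/-- The reduced groupoid C*-algebra `C*_r(𝒢)`: the completion of `C_c(𝒢)` in the reduced norm,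
realized as the closure of the image of `C_c(𝒢)` under the isometric representation
`f ↦ (ρ_x(f))_x`. (In an étale groupoid this image is already a `*`-algebra, the product and
involution being convolution and `f*(g) = conj f(g⁻¹)`, so that `adjoin` adds no elements.) -/
def reducedCStar : NonUnitalStarSubalgebra ℂ (ProdB X) :=
  (NonUnitalStarAlgebra.adjoin ℂ (Set.range (regRep (X := X)))).topologicalClosure

/-- The representation `ρ_x` of `C*_r(𝒢)` on `ℓ²(𝒢_x)`: the continuous extension of `ρ_x` from
`C_c(𝒢)`. -/
def reducedRho (x : X) :
    reducedCStar X →⋆ₙₐ[ℂ] (EllTwo (SourceFiber x) →L[ℂ] EllTwo (SourceFiber x)) :=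
  (BoundedFamilies.eval x).comp (NonUnitalStarSubalgebraClass.subtype (reducedCStar X))

end ReducedCStar

/-- The reduction of a groupoid to a set `A` of units: all arrows with source and range in `A`. -/
@[ext] structure Reduction {X : Type*} (A : Set X) where
  /-- the unit -/
  val : X
  property : val ∈ A

instance Reduction.instGroupoid {X : Type*} [Groupoid X] (A : Set X) : Groupoid (Reduction A) where
  Hom x y := x.1 ⟶ y.1
  id x := 𝟙 x.1
  comp f g := f ≫ g
  id_comp f := Category.id_comp (f : _ ⟶ _)
  comp_id f := Category.comp_id (f : _ ⟶ _)
  assoc f g h := Category.assoc (f : _ ⟶ _) g h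
  inv f := Groupoid.inv f
  inv_comp f := Groupoid.inv_comp (f : _ ⟶ _)
  comp_inv f := Groupoid.comp_inv (f : _ ⟶ _)

/-- The inclusion of the reduction into the groupoid. -/
def Reduction.incl {X : Type*} [Groupoid X] (A : Set X) (γ : Arr (Reduction A)) : Arr X :=
  ⟨γ.src.1, γ.tgt.1, γ.hom⟩

/-- The reduction carries the subspace topology. -/
instance Reduction.instTopologicalSpace {X : Type*} [Groupoid X] [TopologicalSpace (Arr X)]
    (A : Set X) : TopologicalSpace (Arr (Reduction A)) :=
  TopologicalSpace.induced (Reduction.incl A) inferInstance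

theorem Reduction.incl_injective {X : Type*} [Groupoid X] (A : Set X) :
    Function.Injective (Reduction.incl A) := by
  rintro ⟨⟨x, hx⟩, ⟨y, hy⟩, f⟩ ⟨⟨x', hx'⟩, ⟨y', hy'⟩, f'⟩ h
  simp only [Reduction.incl, Arr.mk.injEq] at h
  obtain ⟨rfl, rfl, h⟩ := h
  obtain rfl := eq_of_heq h
  rfl

instance Reduction.instHasOpenBisections {X : Type*} [Groupoid X] [TopologicalSpace (Arr X)]
    [HasOpenBisections X] (A : Set X) : HasOpenBisections (Reduction A) where
  exists_bisection γ := by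
    obtain ⟨U, hU, hγ, hs, hr⟩ := HasOpenBisections.exists_bisection (Reduction.incl A γ)
    refine ⟨Reduction.incl A ⁻¹' U, ⟨U, hU, rfl⟩, hγ, fun δ hδ δ' hδ' h => ?_,
      fun δ hδ δ' hδ' h => ?_⟩
    · exact Reduction.incl_injective A (hs hδ hδ' (congrArg Reduction.val h))
    · exact Reduction.incl_injective A (hr hδ hδ' (congrArg Reduction.val h))

/-! ## The left inverse hull of a left cancellative monoid -/

section Monoid

variable (S : Type*) [Monoid S] [IsLeftCancelMul S]

variable {S} in
open scoped Classical in
/-- The left translation `S → sS`, `t ↦ st`, as a partial bijection of `S`. -/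
def leftTranslation (s : S) : S ≃. S where
  toFun t := some (s * t)
  invFun u := if h : ∃ t, s * t = u then some h.choose else none
  inv t u := by
    constructor
    · intro h
      split_ifs at h with hu
      obtain rfl := Option.some.inj h
      exact congrArg some hu.choose_spec
    · intro h
      have hu : ∃ t, s * t = u := ⟨t, Option.some.inj h⟩
      rw [dif_pos hu]
      exact congrArg some (mul_left_cancel (hu.choose_spec.trans (Option.some.inj h).symm))

variable {S} in
/-- The partial bijections generated by the left translations under composition and inversion. -/
inductive InLeftInverseHull : (S ≃. S) → Prop
  | translation (s : S) : InLeftInverseHull (leftTranslation s)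
  | symm {f : S ≃. S} : InLeftInverseHull f → InLeftInverseHull f.symm
  | trans {f g : S ≃. S} : InLeftInverseHull f → InLeftInverseHull g →
      InLeftInverseHull (f.trans g)

/-- The left inverse hull `I_ℓ(S)`. -/
@[ext] structure LeftInverseHull where
  /-- the partial bijection -/
  val : S ≃. S
  property : InLeftInverseHull val

namespace LeftInverseHull

variable {S}

theorem leftTranslation_one : leftTranslation (1 : S) = PEquiv.refl S :=
  PEquiv.ext fun t => congrArg some (one_mul t)

/-- The product `gh` is the composition "first `h`, then `g`". -/
instance : Monoid (LeftInverseHull S) where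
  mul g h := ⟨h.1.trans g.1, h.2.trans g.2⟩
  one := ⟨PEquiv.refl S, leftTranslation_one (S := S) ▸ InLeftInverseHull.translation 1⟩
  mul_assoc f g h := LeftInverseHull.ext (PEquiv.trans_assoc h.1 g.1 f.1).symm
  one_mul f := LeftInverseHull.ext (PEquiv.trans_refl f.1)
  mul_one f := LeftInverseHull.ext (PEquiv.refl_trans f.1)

instance : InvolutiveInv (LeftInverseHull S) where
  inv g := ⟨g.1.symm, g.2.symm⟩
  inv_inv _ := rfl

/-- The left translation by `s` as an element of `I_ℓ(S)`. -/
def of (s : S) : LeftInverseHull S := ⟨leftTranslation s, .translation s⟩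

theorem mul_apply (g h : LeftInverseHull S) (s : S) : (g * h).1 s = (h.1 s).bind g.1 := rfl

theorem inv_mul_rev (g h : LeftInverseHull S) : (g * h)⁻¹ = h⁻¹ * g⁻¹ := rfl

theorem mul_inv_mul (g : LeftInverseHull S) : g * (g⁻¹ * g) = g := by
  refine LeftInverseHull.ext (PEquiv.ext fun s => ?_)
  change (((g.1 s).bind g.1.symm).bind g.1) = g.1 s
  cases h : g.1 s with
  | none => rfl
  | some t =>
    have : g.1.symm t = some s := (PEquiv.eq_some_iff _).2 h
    simp [this, h]

theorem eq_of_idem {p : LeftInverseHull S} (hp : p * p = p) {s t : S} (h : p.1 s = some t) :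
    t = s := by
  have h1 : (p.1 s).bind p.1 = p.1 s := congrArg (fun q : LeftInverseHull S => q.1 s) hp
  rw [h] at h1
  exact p.1.inj (b := t) h1 h

theorem idem_comm {p q : LeftInverseHull S} (hp : p * p = p) (hq : q * q = q) :
    p * q = q * p := by
  refine LeftInverseHull.ext (PEquiv.ext fun s => ?_)
  rw [mul_apply, mul_apply]
  cases h : q.1 s with
  | none =>
    cases h' : p.1 s with
    | none => rfl
    | some t => rw [eq_of_idem hp h', Option.bind_some, h]; rfl
  | some t =>
    rw [eq_of_idem hq h, Option.bind_some]
    cases h' : p.1 s with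
    | none => rfl
    | some t => rw [eq_of_idem hp h', Option.bind_some, h, eq_of_idem hq h]

theorem idem_inv {p : LeftInverseHull S} (hp : p * p = p) : p⁻¹ = p := by
  refine LeftInverseHull.ext (PEquiv.ext fun s => ?_)
  change p.1.symm s = p.1 s
  refine Option.ext fun t => ?_
  rw [PEquiv.eq_some_iff]
  constructor <;> intro h
  · obtain rfl := eq_of_idem hp h
    exact h
  · obtain rfl := eq_of_idem hp h
    exact h

end LeftInverseHull

open LeftInverseHull

/-- The semigroup `E(S)` of idempotents of `I_ℓ(S)`. -/
@[ext] structure Idem where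
  /-- the element of `I_ℓ(S)` -/
  val : LeftInverseHull S
  property : val * val = val

namespace Idem

variable {S}

instance : Mul (Idem S) where
  mul p q := ⟨p.1 * q.1, by
    rw [mul_assoc, ← mul_assoc q.1, idem_comm q.2 p.2, mul_assoc p.1 q.1, q.2, ← mul_assoc, p.2]⟩

/-- The idempotent `p_S`. -/
instance : One (Idem S) := ⟨⟨1, mul_one 1⟩⟩

/-- The idempotent `g⁻¹g`, the identity map on the domain of `g`. -/
def dom (g : LeftInverseHull S) : Idem S := ⟨g⁻¹ * g, by rw [mul_assoc, mul_inv_mul]⟩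

theorem dom_comm (g : LeftInverseHull S) (p : Idem S) : g⁻¹ * g * p.1 = p.1 * (g⁻¹ * g) :=
  idem_comm (dom g).2 p.2

/-- The idempotent `g⁻¹pg`. -/
def conj (g : LeftInverseHull S) (p : Idem S) : Idem S := ⟨g⁻¹ * p.1 * g, by
  have h : g * g⁻¹ * p.1 = p.1 * (g * g⁻¹) := dom_comm g⁻¹ p
  calc g⁻¹ * p.1 * g * (g⁻¹ * p.1 * g) = g⁻¹ * p.1 * (g * g⁻¹ * p.1) * g := by
        simp only [mul_assoc]
    _ = g⁻¹ * (p.1 * p.1) * (g * (g⁻¹ * g)) := by rw [h]; simp only [mul_assoc]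
    _ = g⁻¹ * p.1 * g := by rw [p.2, mul_inv_mul]⟩

theorem conj_mul (g : LeftInverseHull S) (p q : Idem S) : conj g (p * q) = conj g p * conj g q := by
  refine Idem.ext ?_
  have h : g * g⁻¹ * q.1 = q.1 * (g * g⁻¹) := dom_comm g⁻¹ q
  change g⁻¹ * (p.1 * q.1) * g = g⁻¹ * p.1 * g * (g⁻¹ * q.1 * g)
  calc g⁻¹ * (p.1 * q.1) * g = g⁻¹ * p.1 * q.1 * (g * (g⁻¹ * g)) := by
        rw [mul_inv_mul]; simp only [mul_assoc]
    _ = g⁻¹ * p.1 * (q.1 * (g * g⁻¹)) * g := by simp only [mul_assoc]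
    _ = _ := by rw [← h]; simp only [mul_assoc]

theorem conj_conj (g h : LeftInverseHull S) (p : Idem S) :
    conj g (conj h p) = conj (h * g) p :=
  Idem.ext (by
    change g⁻¹ * (h⁻¹ * p.1 * h) * g = (h * g)⁻¹ * p.1 * (h * g)
    rw [inv_mul_rev]; simp only [mul_assoc])

theorem conj_dom (g h : LeftInverseHull S) : conj g (dom h) = dom (h * g) :=
  Idem.ext (by
    change g⁻¹ * (h⁻¹ * h) * g = (h * g)⁻¹ * (h * g)
    rw [inv_mul_rev]; simp only [mul_assoc])

theorem conj_one (g : LeftInverseHull S) : conj g 1 = dom g :=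
  Idem.ext (by change g⁻¹ * 1 * g = g⁻¹ * g; rw [mul_one])

theorem one_mul' (p : Idem S) : 1 * p = p := Idem.ext (one_mul p.1)

theorem one_conj (p : Idem S) : conj 1 p = p :=
  Idem.ext (by
    change (1 : LeftInverseHull S)⁻¹ * p.1 * 1 = p.1
    rw [idem_inv (mul_one 1), one_mul, mul_one])

theorem conj_inv_conj (g : LeftInverseHull S) (p : Idem S) :
    conj g (conj g⁻¹ p) = dom g * p := by
  refine Idem.ext ?_
  change g⁻¹ * (g⁻¹⁻¹ * p.1 * g⁻¹) * g = g⁻¹ * g * p.1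
  have h := dom_comm g p
  calc g⁻¹ * (g⁻¹⁻¹ * p.1 * g⁻¹) * g = g⁻¹ * g * p.1 * (g⁻¹ * g) := by
        rw [inv_inv]; simp only [mul_assoc]
    _ = g⁻¹ * (g * (g⁻¹ * g)) * p.1 := by rw [mul_assoc (g⁻¹ * g), ← h]; simp only [mul_assoc]
    _ = _ := by rw [mul_inv_mul]

theorem inv_mul_conj (g : LeftInverseHull S) (p : Idem S) :
    g⁻¹ * (conj g⁻¹ p).1 = (g * p.1)⁻¹ := by
  change g⁻¹ * (g⁻¹⁻¹ * p.1 * g⁻¹) = _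
  rw [inv_mul_rev, idem_inv p.2, inv_inv]
  calc g⁻¹ * (g * p.1 * g⁻¹) = (g⁻¹ * g * p.1) * g⁻¹ := by simp only [mul_assoc]
    _ = p.1 * (g⁻¹ * (g⁻¹⁻¹ * g⁻¹)) := by rw [dom_comm, inv_inv]; simp only [mul_assoc]
    _ = _ := by rw [mul_inv_mul]

theorem mul_conj (g : LeftInverseHull S) (q : Idem S) : g * (conj g q).1 = q.1 * g := by
  change g * (g⁻¹ * q.1 * g) = _
  have h : g * g⁻¹ * q.1 = q.1 * (g * g⁻¹) := dom_comm g⁻¹ q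
  calc g * (g⁻¹ * q.1 * g) = g * g⁻¹ * q.1 * g := by simp only [mul_assoc]
    _ = q.1 * (g * (g⁻¹ * g)) := by rw [h]; simp only [mul_assoc]
    _ = _ := by rw [mul_inv_mul]

end Idem

/-! ## Semi-characters and the Paterson groupoid -/

/-- Semi-characters of `E(S)`: semigroup homomorphisms `E(S) → {0, 1}` that are not identically
zero. -/
@[ext] structure SemiChar where
  /-- the underlying function, `true` being `1` and `false` being `0` -/
  toFun : Idem S → Bool
  map_mul : ∀ p q, toFun (p * q) = (toFun p && toFun q)
  ne_zero : ∃ p, toFun p = true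

namespace SemiChar

variable {S}

instance : CoeFun (SemiChar S) (fun _ => Idem S → Bool) := ⟨toFun⟩

/-- The topology of pointwise convergence. -/
instance : TopologicalSpace (SemiChar S) := TopologicalSpace.induced toFun inferInstance

theorem map_one (χ : SemiChar S) : χ 1 = true := by
  obtain ⟨p, hp⟩ := χ.ne_zero
  rw [← Idem.one_mul' p, χ.map_mul, Bool.and_eq_true] at hp
  exact hp.1

/-- The semi-character `χ_s`, with `χ_s(p_X) = 1` if and only if `s ∈ X`. -/
def point (s : S) : SemiChar S where
  toFun p := (p.1.1 s).isSome
  map_mul p q := by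
    change ((q.1.1 s).bind p.1.1).isSome = _
    cases h : q.1.1 s with
    | none => simp
    | some t => rw [eq_of_idem q.2 h]; simp
  ne_zero := ⟨1, rfl⟩

/-- The elements `g` of `I_ℓ(S)` with `χ(g⁻¹g) = 1` and `χ(g⁻¹ · g) = ψ`. -/
@[ext] structure PreHom (χ ψ : SemiChar S) where
  /-- the element `g` -/
  val : LeftInverseHull S
  property : χ (Idem.dom val) = true ∧ ∀ p, ψ p = χ (Idem.conj val p)

/-- `(g₁, χ) ∼ (g₂, χ)` if `g₁p = g₂p` for some idempotent `p` with `χ(p) = 1`. -/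
instance germSetoid (χ ψ : SemiChar S) : Setoid (PreHom χ ψ) where
  r g h := ∃ p : Idem S, g.1 * p.1 = h.1 * p.1 ∧ χ p = true
  iseqv :=
    { refl := fun _ => ⟨1, rfl, χ.map_one⟩
      symm := fun ⟨p, h, hp⟩ => ⟨p, h.symm, hp⟩
      trans := by
        rintro f g h ⟨p, h1, hp⟩ ⟨q, h2, hq⟩
        refine ⟨p * q, ?_, by rw [χ.map_mul, hp, hq]; rfl⟩
        change f.1 * (p.1 * q.1) = h.1 * (p.1 * q.1)
        rw [← mul_assoc, h1, idem_comm p.2 q.2, ← mul_assoc h.1, ← h2, mul_assoc, mul_assoc,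
          idem_comm p.2 q.2] }

/-- The arrows `[g, χ]` from `χ` to `ψ`. -/
def Germ (χ ψ : SemiChar S) : Type _ := Quotient (germSetoid χ ψ)

namespace PreHom

variable {χ ψ θ : SemiChar S}

/-- the identity representative -/
def id (χ : SemiChar S) : PreHom χ χ := ⟨1, by
  refine ⟨?_, fun p => by rw [Idem.one_conj]⟩
  rw [← Idem.conj_one, Idem.one_conj]
  exact χ.map_one⟩

/-- `(h, ψ) (g, χ) = (hg, χ)` for `ψ = χ(g⁻¹ · g)` -/
def comp (g : PreHom χ ψ) (h : PreHom ψ θ) : PreHom χ θ := ⟨h.1 * g.1, by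
  refine ⟨?_, fun p => ?_⟩
  · rw [← Idem.conj_dom, ← g.2.2]
    exact h.2.1
  · rw [← Idem.conj_conj, ← g.2.2, h.2.2]⟩

theorem src_eq (g : PreHom χ ψ) (p : Idem S) : χ p = ψ (Idem.conj g.1⁻¹ p) := by
  rw [g.2.2, Idem.conj_inv_conj, χ.map_mul, g.2.1, Bool.true_and]

/-- `(g, χ)⁻¹ = (g⁻¹, χ(g⁻¹ · g))` -/
def inv (g : PreHom χ ψ) : PreHom ψ χ := ⟨g.1⁻¹, by
  refine ⟨?_, g.src_eq⟩
  have h : Idem.conj g.1 (Idem.dom g.1⁻¹) = Idem.dom g.1 := by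
    rw [Idem.conj_dom]
    refine Idem.ext ?_
    change (g.1⁻¹ * g.1)⁻¹ * (g.1⁻¹ * g.1) = g.1⁻¹ * g.1
    rw [show (g.1⁻¹ * g.1)⁻¹ = g.1⁻¹ * g.1 from idem_inv (Idem.dom g.1).2]
    exact (Idem.dom g.1).2
  rw [g.2.2, h]
  exact g.2.1⟩

theorem comp_congr (g g' : PreHom χ ψ) (hg : g ≈ g') (h h' : PreHom ψ θ) (hh : h ≈ h') :
    comp g h ≈ comp g' h' := by
  obtain ⟨p, h1, hp⟩ := hg
  obtain ⟨q, h2, hq⟩ := hh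
  refine ⟨p * Idem.conj g.1 q, ?_, by rw [χ.map_mul, hp, ← g.2.2, hq]; rfl⟩
  have hc : p.1 * (Idem.conj g.1 q).1 = (Idem.conj g.1 q).1 * p.1 :=
    idem_comm p.2 (Idem.conj g.1 q).2
  have key : g.1 * (p.1 * (Idem.conj g.1 q).1) = q.1 * (g.1 * p.1) := by
    rw [hc, ← mul_assoc, Idem.mul_conj, mul_assoc]
  change h.1 * g.1 * (p.1 * (Idem.conj g.1 q).1) = h'.1 * g'.1 * (p.1 * (Idem.conj g.1 q).1)
  rw [mul_assoc, key, mul_assoc h'.1, ← mul_assoc g'.1, ← h1, mul_assoc g.1, key, ← mul_assoc,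
    h2, mul_assoc]

theorem inv_congr (g g' : PreHom χ ψ) (hg : g ≈ g') : inv g ≈ inv g' := by
  obtain ⟨p, h1, hp⟩ := hg
  refine ⟨Idem.conj g.1⁻¹ p, ?_, by rw [← g.src_eq, hp]⟩
  have hq : Idem.conj g.1⁻¹ p = Idem.conj g'.1⁻¹ p := by
    have key : ∀ k : LeftInverseHull S, (Idem.conj k⁻¹ p).1 = (k * p.1) * (k * p.1)⁻¹ := by
      intro k
      change k⁻¹⁻¹ * p.1 * k⁻¹ = _
      rw [inv_mul_rev, idem_inv p.2, inv_inv, mul_assoc k p.1 (p.1 * _), ← mul_assoc p.1, p.2, mul_assoc]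
    refine Idem.ext ?_
    rw [key, key, h1]
  change g.1⁻¹ * (Idem.conj g.1⁻¹ p).1 = g'.1⁻¹ * (Idem.conj g.1⁻¹ p).1
  rw [Idem.inv_mul_conj, hq, Idem.inv_mul_conj, h1]

end PreHom

/-- The Paterson groupoid `𝒢(I_ℓ(S))` with unit space the semi-characters of `E(S)`. -/
instance : Groupoid (SemiChar S) where
  Hom χ ψ := Germ χ ψ
  id χ := Quotient.mk _ (PreHom.id χ)
  comp := Quotient.map₂ PreHom.comp fun g g' hg h h' hh => PreHom.comp_congr g g' hg h h' hh
  id_comp := by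
    rintro _ _ ⟨g⟩
    exact Quotient.sound ⟨1, congrArg (· * _) (mul_one g.1), SemiChar.map_one _⟩
  comp_id := by
    rintro _ _ ⟨g⟩
    exact Quotient.sound ⟨1, congrArg (· * _) (one_mul g.1), SemiChar.map_one _⟩
  assoc := by
    rintro _ _ _ _ ⟨f⟩ ⟨g⟩ ⟨h⟩
    exact Quotient.sound ⟨1, congrArg (· * _) (mul_assoc h.1 g.1 f.1).symm, SemiChar.map_one _⟩
  inv := Quotient.map PreHom.inv PreHom.inv_congr
  inv_comp := by
    rintro χ ψ ⟨g⟩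
    refine Quotient.sound ⟨Idem.dom g.1⁻¹, ?_, (PreHom.inv g).2.1⟩
    change g.1 * g.1⁻¹ * (Idem.dom g.1⁻¹).1 = 1 * (Idem.dom g.1⁻¹).1
    rw [one_mul]
    exact (Idem.dom g.1⁻¹).2
  comp_inv := by
    rintro χ ψ ⟨g⟩
    refine Quotient.sound ⟨Idem.dom g.1, ?_, g.2.1⟩
    change g.1⁻¹ * g.1 * (Idem.dom g.1).1 = 1 * (Idem.dom g.1).1
    rw [one_mul]
    exact (Idem.dom g.1).2

/-- The set `D(g, U)` of arrows of the form `[g, χ]` with `χ ∈ U`. -/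
def basicSet (g : LeftInverseHull S) (U : Set (SemiChar S)) : Set (Arr (SemiChar S)) :=
  {γ | γ.src ∈ U ∧ ∃ hg, γ.hom = Quotient.mk (germSetoid γ.src γ.tgt) ⟨g, hg⟩}

/-- The topology of the Paterson groupoid, with basis the sets `D(g, U)`, where `U` is an open
subset of `{χ | χ(g⁻¹g) = 1}`. -/
instance : TopologicalSpace (Arr (SemiChar S)) :=
  TopologicalSpace.generateFrom {D | ∃ (g : LeftInverseHull S) (U : Set (SemiChar S)),
    IsOpen U ∧ U ⊆ {χ | χ (Idem.dom g) = true} ∧ D = basicSet g U}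

theorem continuous_eval (p : Idem S) : Continuous fun χ : SemiChar S => χ p :=
  (continuous_apply p).comp continuous_induced_dom

instance : HasOpenBisections (SemiChar S) where
  exists_bisection := by
    rintro ⟨χ, ψ, ⟨g⟩⟩
    refine ⟨basicSet g.1 {χ | χ (Idem.dom g.1) = true}, ?_, ⟨g.2.1, g.2, rfl⟩, ?_, ?_⟩
    · refine TopologicalSpace.isOpen_generateFrom_of_mem ⟨_, _, ?_, subset_rfl, rfl⟩
      exact (isOpen_discrete {true}).preimage (continuous_eval (Idem.dom g.1))
    · rintro ⟨χ₁, ψ₁, _⟩ ⟨-, h₁, e₁⟩ ⟨χ₂, ψ₂, _⟩ ⟨-, h₂, e₂⟩ h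
      dsimp only at h h₁ h₂ e₁ e₂
      subst h
      have : ψ₁ = ψ₂ := SemiChar.ext (funext fun p => by rw [h₁.2, h₂.2])
      subst this
      rw [e₁, e₂]
    · rintro ⟨χ₁, ψ₁, _⟩ ⟨-, h₁, e₁⟩ ⟨χ₂, ψ₂, _⟩ ⟨-, h₂, e₂⟩ h
      dsimp only at h h₁ h₂ e₁ e₂
      subst h
      have : χ₁ = χ₂ := SemiChar.ext (funext fun p => by
        rw [PreHom.src_eq ⟨_, h₁⟩, PreHom.src_eq ⟨_, h₂⟩])
      subst this
      rw [e₁, e₂]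

end SemiChar

/-- The set `Ω(S)`: the closure of the orbit of `χ_e` under the Paterson groupoid. -/
def Omega : Set (SemiChar S) := closure {χ | Nonempty (SemiChar.point (1 : S) ⟶ χ)}

/-- The groupoid `𝒢_P(S)`: the reduction of the Paterson groupoid of `I_ℓ(S)` to `Ω(S)`. -/
abbrev GroupoidP : Type _ := Reduction (Omega S)

/-- The unit `χ_e` of `𝒢_P(S)`. -/
def chiE : GroupoidP S := ⟨SemiChar.point 1, subset_closure ⟨𝟙 _⟩⟩

variable {S}

theorem translation_conj (s : S) (p : Idem S) :
    SemiChar.point s p = SemiChar.point (1 : S) (Idem.conj (of s) p) := by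
  have hs : (of s).1 1 = some s := congrArg some (mul_one s)
  have hs' : (of s)⁻¹.1 s = some 1 := (PEquiv.eq_some_iff _).2 hs
  change (p.1.1 s).isSome = (((of s).1 1).bind fun t => (p.1.1 t).bind (of s)⁻¹.1).isSome
  rw [hs, Option.bind_some]
  cases h : p.1.1 s with
  | none => rfl
  | some t => rw [eq_of_idem p.2 h, Option.bind_some, hs']; rfl

theorem point_dom_of (s : S) : SemiChar.point (1 : S) (Idem.dom (of s)) = true := by
  rw [← Idem.conj_one, ← translation_conj]
  exact SemiChar.map_one _

/-- The arrow `[s, χ_e]` of the Paterson groupoid, which goes from `χ_e` to `χ_s`. -/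
def translationGerm (s : S) : SemiChar.point (1 : S) ⟶ SemiChar.point s :=
  Quotient.mk (SemiChar.germSetoid _ _) ⟨of s, point_dom_of s, translation_conj s⟩

/-- The arrow `[s, χ_e]` as an element of the source fiber of `χ_e` in `𝒢_P(S)`. -/
def toFiber (s : S) : SourceFiber (chiE S) :=
  ⟨⟨SemiChar.point s, subset_closure ⟨translationGerm s⟩⟩, translationGerm s⟩

/-- Elements of `I_ℓ(S)` are partial maps of right `S`-sets. -/
theorem InLeftInverseHull.equivariant {f : S ≃. S} (hf : InLeftInverseHull f) :
    ∀ {s t : S}, f s = some t → ∀ u, f (s * u) = some (t * u) := by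
  suffices h : ∀ {s t : S}, (f s = some t → ∀ u, f (s * u) = some (t * u)) ∧
      (f.symm s = some t → ∀ u, f.symm (s * u) = some (t * u)) from
    fun {s t} => (@h s t).1
  induction hf with
  | translation s =>
    intro t v
    have key : ∀ {t v : S}, leftTranslation s t = some v → ∀ u,
        leftTranslation s (t * u) = some (v * u) := by
      intro t v h u
      obtain rfl := Option.some.inj h
      exact congrArg some (mul_assoc s t u).symm
    refine ⟨key, fun h u => ?_⟩
    rw [PEquiv.eq_some_iff] at h ⊢
    exact key h u
  | symm _ ih => intro s t; exact ⟨ih.2, ih.1⟩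
  | @trans f g _ _ ihf ihg =>
    intro s t
    constructor
    · intro h u
      obtain ⟨v, h1, h2⟩ := (PEquiv.trans_eq_some f g s t).1 h
      exact (PEquiv.trans_eq_some f g _ _).2 ⟨v * u, ihf.1 h1 u, ihg.1 h2 u⟩
    · intro h u
      rw [PEquiv.symm_trans_rev] at h ⊢
      obtain ⟨v, h1, h2⟩ := (PEquiv.trans_eq_some g.symm f.symm s t).1 h
      exact (PEquiv.trans_eq_some g.symm f.symm _ _).2 ⟨v * u, ihg.2 h1 u, ihf.2 h2 u⟩

theorem toFiber_bijective : Function.Bijective (toFiber (S := S)) := by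
  constructor
  · intro s t h
    have hψ : SemiChar.point s = SemiChar.point t :=
      congrArg (fun x : SourceFiber (chiE S) => x.1.1) h
    have key : ∀ (x y : GroupoidP S) (g : chiE S ⟶ x) (k : chiE S ⟶ y),
        (⟨x, g⟩ : SourceFiber (chiE S)) = ⟨y, k⟩ → ∀ (g₀ : SemiChar.PreHom _ x.1)
        (k₀ : SemiChar.PreHom _ y.1), g = Quotient.mk (SemiChar.germSetoid _ _) g₀ →
        k = Quotient.mk (SemiChar.germSetoid _ _) k₀ → g₀.1.1 1 = k₀.1.1 1 := by
      intro x y g k h g₀ k₀ hg hk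
      obtain rfl : x = y := congrArg Sigma.fst h
      obtain rfl : g = k := by simpa using h
      obtain ⟨p, hp, h1⟩ := Quotient.exact (hg.symm.trans hk)
      obtain ⟨u, hu⟩ := Option.isSome_iff_exists.1 (show (p.1.1 1).isSome = true from h1)
      have hp1 : p.1.1 1 = some 1 := by rw [hu, eq_of_idem p.2 hu]
      have := congrArg (fun q : LeftInverseHull S => q.1 1) hp
      simpa [mul_apply, hp1] using this
    have := key _ _ _ _ h _ _ rfl rfl
    have h2 : some (s * 1) = some (t * 1) := this
    simpa using h2
  · rintro ⟨⟨ψ, hψ⟩, ⟨g⟩⟩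
    have hdom : (((g.1.1 1).bind g.1⁻¹.1)).isSome = true := g.2.1
    obtain ⟨s, hs⟩ : ∃ s, g.1.1 1 = some s := by
      cases h : g.1.1 1 with
      | none => simp [h] at hdom
      | some s => exact ⟨s, rfl⟩
    have hg : g.1 = of s := LeftInverseHull.ext (PEquiv.ext fun t => by
      have := g.1.2.equivariant hs t
      rw [one_mul] at this
      exact this)
    refine ⟨s, ?_⟩
    obtain ⟨g, hg1⟩ := g
    dsimp only at hg
    subst hg
    have : SemiChar.point s = ψ := SemiChar.ext (funext fun p => by
      rw [translation_conj]
      exact (hg1.2 p).symm)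
    subst this
    rfl

variable (S) in
/-- The bijection `S ≅ 𝒢_P(S)_{χ_e}`, `s ↦ [s, χ_e]`. -/
def fiberEquiv : S ≃ SourceFiber (chiE S) := Equiv.ofBijective toFiber toFiber_bijective

/-! ## Strong C*-regularity -/

variable (S) in
open scoped Classical in
/-- The constructible right ideals: the domains of the idempotents in `I_ℓ(S)`, that is, the
subsets `X` of `S` such that the identity map of `X` lies in `I_ℓ(S)`. -/
def constructibleIdeals : Set (Set S) := {X | InLeftInverseHull (PEquiv.ofSet X)}

open scoped Classical in
/-- The idempotent `p_X`, the identity map of the constructible ideal `X`. -/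
def idemOf (X : constructibleIdeals S) : LeftInverseHull S := ⟨PEquiv.ofSet X.1, X.2⟩

variable (S) in
/-- Strong C*-regularity of a left cancellative monoid. -/
def StronglyCStarRegular : Prop :=
  ∀ (n m : ℕ) (h : Fin n → LeftInverseHull S) (X : constructibleIdeals S)
    (Xs : Fin m → constructibleIdeals S),
    (X.1 \ ⋃ i, (Xs i).1).Nonempty →
    X.1 \ ⋃ i, (Xs i).1 ⊆ ⋃ k, {s : S | (h k).1 s = some s} →
    ∃ (l : ℕ) (Y : Fin l → constructibleIdeals S) (k : Fin l → Fin n),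
      X.1 \ ⋃ i, (Xs i).1 ⊆ ⋃ j, (Y j).1 ∧
      ∀ j, h (k j) * idemOf (Y j) = idemOf (Y j)

/-! ## The reduced C*-algebra of the monoid -/

open scoped Classical in
theorem exists_leftRegular (s : S) : ∃ T : EllTwo S →L[ℂ] EllTwo S,
    ∀ t : S, T (lp.single 2 t (1 : ℂ)) = lp.single 2 (s * t) (1 : ℂ) := by
  obtain ⟨T, -, e⟩ := EllTwo.exists_weighted (α := S) (β := S)
    (fun u => if h : ∃ t, s * t = u then h.choose else 1)
    (fun u => if ∃ t, s * t = u then 1 else 0) 1 zero_le_one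
    (by
      intro u hu v hv huv
      have hu' : ∃ t, s * t = u := by
        by_contra hc
        exact hu (if_neg hc)
      have hv' : ∃ t, s * t = v := by
        by_contra hc
        exact hv (if_neg hc)
      simp only [dif_pos hu', dif_pos hv'] at huv
      rw [← hu'.choose_spec, ← hv'.choose_spec, huv])
    (fun u => by split_ifs <;> simp)
  refine ⟨T, fun t => lp.ext (funext fun u => ?_)⟩
  rw [e]
  by_cases hu : ∃ v, s * v = u
  · rw [if_pos hu, dif_pos hu, one_mul]
    have hc := hu.choose_spec
    generalize hu.choose = v at hc
    subst hc
    by_cases hvt : v = t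
    · subst hvt
      simp
    · have : s * v ≠ s * t := fun h => hvt (mul_left_cancel h)
      simp [lp.single_apply, hvt, this]
  · rw [if_neg hu, zero_mul]
    have : u ≠ s * t := fun h => hu ⟨t, h.symm⟩
    simp [lp.single_apply, this]

/-- The operator `λ_s` on `ℓ²(S)`, `λ_s δ_t = δ_{st}`. -/
def leftRegular (s : S) : EllTwo S →L[ℂ] EllTwo S := (exists_leftRegular s).choose

open scoped Classical in
theorem leftRegular_single (s t : S) :
    leftRegular s (lp.single 2 t (1 : ℂ)) = lp.single 2 (s * t) (1 : ℂ) :=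
  (exists_leftRegular s).choose_spec t

variable (S) in
/-- The reduced C*-algebra `C*_r(S)`: the C*-algebra generated by the operators `λ_s`. -/
def monoidReducedCStar : NonUnitalStarSubalgebra ℂ (EllTwo S →L[ℂ] EllTwo S) :=
  (NonUnitalStarAlgebra.adjoin ℂ (Set.range (leftRegular (S := S)))).topologicalClosure

end Monoid

end

noncomputable section

/-!
Evaluation at `χ_e` is isometric because finitely many germs at a point `χ ∈ Ω(S)` are realised at
a single point `s` of `S`: whether `[g, χ] = [h, χ]` can be read off from whether `g s = h s`.
Equality of germs is an open condition and the points of `S` are dense in `Ω(S)`, so the issue is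
to keep distinct germs distinct; if every point of `S` near `χ` were fixed by one of `h₁, …, hₙ`,
strong C*-regularity would produce a `Y` with `χ(Y) = 1` on which some `hₖ` is the identity, and
then `[hₖ, χ]` would be a unit. Consequently, if `a` is a combination of characteristic functions
of the bisections `{[g, χ]}`, `g ∈ I_ℓ(S)`, then every finite block of the matrix of `ρ_χ(a)` is
also a block of the matrix of `ρ_{χ_e}(a)`, whence `‖ρ_χ(a)‖ ≤ ‖ρ_{χ_e}(a)‖`.

These combinations are dense. On one bisection this is the Stone–Weierstrass theorem; a function
supported on a general open Hausdorff set is cut into pieces along a partition of its support into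
compact open subsets of bisections. As `I_ℓ(S)` is generated by `S`, they form the `*`-algebra
generated by the characteristic functions of the `{[s, χ]}`, `s ∈ S`, which `ρ_{χ_e}` sends to the
`λ_s`; so the image of `ρ_{χ_e}` is `C*_r(S)`.
-/

open CategoryTheory Topology
open scoped ENNReal

namespace EllTwo

variable {α β : Type*}

open scoped Classical in
/-- The standard basis vector `δ_i`. The classical decidability instance is fixed here once and for
all: the index types below also carry other instances. -/
def basisVector (i : α) : EllTwo α := lp.single 2 i 1

/-- The matrix entry `(Tδ_i)(j)` of an operator `T`. -/
def entry (T : EllTwo α →L[ℂ] EllTwo β) (i : α) (j : β) : ℂ := T (basisVector i) j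

theorem apply_eq_inner (ξ : EllTwo α) (i : α) : ξ i = inner ℂ (basisVector i) ξ := by
  simp [basisVector, lp.inner_single_left]

open scoped Classical in
theorem basisVector_apply (i j : α) : basisVector i j = if j = i then 1 else 0 := by
  rw [basisVector, lp.single_apply, Pi.single_apply]

theorem entry_add (T T' : EllTwo α →L[ℂ] EllTwo β) (i : α) (j : β) :
    entry (T + T') i j = entry T i j + entry T' i j := rfl

theorem entry_smul (c : ℂ) (T : EllTwo α →L[ℂ] EllTwo β) (i : α) (j : β) :
    entry (c • T) i j = c * entry T i j := rfl

theorem entry_adjoint (T : EllTwo α →L[ℂ] EllTwo β) (j : β) (i : α) :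
    entry T.adjoint j i = starRingEnd ℂ (entry T i j) := by
  rw [entry, entry, apply_eq_inner, apply_eq_inner, ContinuousLinearMap.adjoint_inner_right,
    inner_conj_symm]

open scoped Classical in
theorem apply_sum_single (T : EllTwo α →L[ℂ] EllTwo β) (t : Finset α) (c : α → ℂ) (j : β) :
    T (∑ i ∈ t, lp.single 2 i (c i)) j = ∑ i ∈ t, c i * entry T i j := by
  have hsingle (i : α) : lp.single 2 i (c i) = c i • basisVector i := by
    rw [basisVector, ← lp.single_smul, smul_eq_mul, mul_one]
  simp only [hsingle, map_sum, map_smul, lp.coeFn_sum, Finset.sum_apply]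
  rfl

open scoped Classical in
theorem tendsto_apply_sum_single (T : EllTwo α →L[ℂ] EllTwo β) (ξ : EllTwo α) :
    Filter.Tendsto (fun t : Finset α => T (∑ i ∈ t, lp.single 2 i (ξ i))) Filter.atTop
      (𝓝 (T ξ)) :=
  (T.continuous.tendsto ξ).comp (lp.hasSum_single ENNReal.ofNat_ne_top ξ)

theorem ext_entry {T R : EllTwo α →L[ℂ] EllTwo β} (h : ∀ i j, entry T i j = entry R i j) :
    T = R := by
  classical
  refine ContinuousLinearMap.ext fun ξ =>
    tendsto_nhds_unique (tendsto_apply_sum_single T ξ) ?_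
  convert tendsto_apply_sum_single R ξ using 2 with t
  refine lp.ext (funext fun j => ?_)
  simp only [apply_sum_single, h]

theorem opNorm_le_of_finite_blocks (T : EllTwo α →L[ℂ] EllTwo α) {C : ℝ} (hC : 0 ≤ C)
    (h : ∀ t : Finset α, ∃ R : EllTwo α →L[ℂ] EllTwo α, ‖R‖ ≤ C ∧
      ∀ i ∈ t, ∀ j ∈ t, entry T i j = entry R i j) : ‖T‖ ≤ C := by
  classical
  have h2 : (0 : ℝ) < (2 : ℝ≥0∞).toReal := by norm_num
  have hfin (t : Finset α) (c : α → ℂ) :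
      ‖T (∑ i ∈ t, lp.single 2 i (c i))‖ ≤ C * ‖(∑ i ∈ t, lp.single 2 i (c i) : EllTwo α)‖ := by
    refine lp.norm_le_of_forall_sum_le h2 (by positivity) fun t' => ?_
    obtain ⟨R, hR, hT⟩ := h (t ∪ t')
    have hTR : ∀ j ∈ t', T (∑ i ∈ t, lp.single 2 i (c i)) j =
        R (∑ i ∈ t, lp.single 2 i (c i)) j := fun j hj => by
      rw [apply_sum_single, apply_sum_single]
      exact Finset.sum_congr rfl fun i hi => by
        rw [hT i (Finset.mem_union_left _ hi) j (Finset.mem_union_right _ hj)]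
    rw [Finset.sum_congr rfl fun j hj => by rw [hTR j hj]]
    refine (lp.sum_rpow_le_norm_rpow h2 _ _).trans ?_
    exact Real.rpow_le_rpow (norm_nonneg _) (R.le_of_opNorm_le hR _) h2.le
  refine T.opNorm_le_bound hC fun ξ => ?_
  exact le_of_tendsto_of_tendsto' (tendsto_apply_sum_single T ξ).norm
    ((tendsto_apply_sum_single (.id ℂ _) ξ).norm.const_mul C) fun t => hfin t _

theorem exists_submatrix (T : EllTwo β →L[ℂ] EllTwo β) (ι : α → β) (t : Finset α)
    (hι : Set.InjOn ι t) : ∃ R : EllTwo α →L[ℂ] EllTwo α, ‖R‖ ≤ ‖T‖ ∧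
      ∀ i ∈ t, ∀ j ∈ t, entry R i j = entry T (ι i) (ι j) := by
  classical
  obtain ⟨W, hW, hWapply⟩ := exists_weighted ι (fun i => if i ∈ t then 1 else 0) 1 zero_le_one
    (hι.mono fun i hi => by simpa using hi) fun i => by split_ifs <;> simp
  have hadj : ∀ i ∈ t, W.adjoint (basisVector i) = basisVector (ι i) := by
    intro i hi
    refine lp.ext (funext fun b => (entry_adjoint W i b).trans ?_)
    rw [entry, hWapply, if_pos hi, one_mul, basisVector_apply, basisVector_apply,
      apply_ite (starRingEnd ℂ), map_one, map_zero]
    exact if_congr eq_comm rfl rfl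
  refine ⟨W ∘L T ∘L W.adjoint, ?_, fun i hi j hj => ?_⟩
  · calc ‖W ∘L T ∘L W.adjoint‖ ≤ ‖W‖ * (‖T‖ * ‖W.adjoint‖) :=
          (ContinuousLinearMap.opNorm_comp_le _ _).trans <| by
            gcongr; exact ContinuousLinearMap.opNorm_comp_le _ _
      _ ≤ 1 * (‖T‖ * 1) := by rw [LinearIsometryEquiv.norm_map]; gcongr
      _ = ‖T‖ := by ring
  · change W (T (W.adjoint (basisVector i))) j = _
    rw [hadj i hi, hWapply, if_pos hj, one_mul]
    rfl

theorem opNorm_le_of_forall_block (T : EllTwo α →L[ℂ] EllTwo α) (R : EllTwo β →L[ℂ] EllTwo β)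
    (h : ∀ t : Finset α, ∃ ι : α → β, Set.InjOn ι t ∧ ∀ i ∈ t, ∀ j ∈ t,
      entry T i j = entry R (ι i) (ι j)) : ‖T‖ ≤ ‖R‖ := by
  refine opNorm_le_of_finite_blocks T (norm_nonneg R) fun t => ?_
  obtain ⟨ι, hι, hTR⟩ := h t
  obtain ⟨Q, hQ, hQR⟩ := exists_submatrix R ι t hι
  exact ⟨Q, hQ, fun i hi j hj => (hTR i hi j hj).trans (hQR i hi j hj).symm⟩

theorem opNorm_le_of_monomial (T : EllTwo α →L[ℂ] EllTwo β) {C : ℝ} (hC : 0 ≤ C)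
    (hcol : ∀ i, {j | entry T i j ≠ 0}.Subsingleton)
    (hrow : ∀ j, {i | entry T i j ≠ 0}.Subsingleton) (hT : ∀ i j, ‖entry T i j‖ ≤ C) :
    ‖T‖ ≤ C := by
  classical
  cases isEmpty_or_nonempty α with
  | inl _ => simpa [ext_entry (T := T) (R := 0) fun i => isEmptyElim i] using hC
  | inr _ =>
    let φ (j : β) : α := Classical.epsilon fun i => entry T i j ≠ 0
    have hφ {i j} (hij : entry T i j ≠ 0) : φ j = i :=
      hrow j (Classical.epsilon_spec (p := fun i => entry T i j ≠ 0) ⟨i, hij⟩) hij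
    obtain ⟨R, hR, hRapply⟩ := exists_weighted φ (fun j => entry T (φ j) j) C hC
      (fun j hj j' hj' h => hcol (φ j) hj (by rwa [Set.mem_ofPred, h])) fun j => hT _ _
    rwa [ext_entry (T := T) (R := R) fun i j => ?_]
    rw [entry.eq_1 R, hRapply, basisVector_apply]
    by_cases hij : φ j = i
    · rw [if_pos hij, hij, mul_one]
    · rw [if_neg hij, mul_zero]
      exact not_not.1 fun h => hij (hφ h)

theorem entry_conj_reindex (e : α ≃ β) (T : EllTwo α →L[ℂ] EllTwo α) (i j : β) :
    entry ((reindex e).conjStarAlgEquiv T) i j = entry T (e.symm i) (e.symm j) := by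
  have hbasis : (reindex e).symm (basisVector i) = basisVector (e.symm i) := by
    refine lp.ext (funext fun a => ?_)
    change basisVector i (e a) = _
    classical
    rw [basisVector_apply, basisVector_apply]
    exact if_congr e.eq_symm_apply.symm rfl rfl
  rw [entry, LinearIsometryEquiv.conjStarAlgEquiv_apply_apply, hbasis]
  rfl

end EllTwo

namespace BoundedFamilies

variable {X : Type*} {H : X → Type*} [∀ x, NormedAddCommGroup (H x)]
  [∀ x, InnerProductSpace ℂ (H x)] [∀ x, CompleteSpace (H x)]

theorem ext_eval {a b : BoundedFamilies H} (h : ∀ x, eval x a = eval x b) : a = b :=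
  lp.ext (funext h)

theorem norm_eval_le (x : X) (a : BoundedFamilies H) : ‖eval x a‖ ≤ ‖a‖ :=
  lp.norm_apply_le_norm ENNReal.top_ne_zero a x

theorem norm_le {a : BoundedFamilies H} {C : ℝ} (hC : 0 ≤ C) (h : ∀ x, ‖eval x a‖ ≤ C) :
    ‖a‖ ≤ C :=
  lp.norm_le_of_forall_le hC h

open scoped CStarAlgebra in
theorem continuous_eval (x : X) : Continuous (eval (H := H) x) :=
  map_continuous _

end BoundedFamilies

section RegularRepresentations

variable {X : Type*} [Groupoid X] [TopologicalSpace (Arr X)] [HasOpenBisections X]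

theorem entry_rho (x : X) (f : Cc X) (k l : SourceFiber x) :
    EllTwo.entry (rho x f) k l = (f : Arr X → ℂ) ⟨k.1, l.1, Groupoid.inv k.2 ≫ l.2⟩ := by
  have hquot {h : RangeFiber l.1} (hk : (⟨h.1, l.2 ≫ Groupoid.inv h.2⟩ : SourceFiber x) = k) :
      h = ⟨k.1, Groupoid.inv k.2 ≫ l.2⟩ := by
    subst hk
    simp
  rw [EllTwo.entry, rho_apply, tsum_eq_single (⟨k.1, Groupoid.inv k.2 ≫ l.2⟩ : RangeFiber l.1)]
  · have hk : (⟨k.1, l.2 ≫ Groupoid.inv (Groupoid.inv k.2 ≫ l.2)⟩ : SourceFiber x) = k := by simp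
    rw [EllTwo.basisVector_apply, if_pos hk, mul_one]
  · intro h hh
    rw [EllTwo.basisVector_apply, if_neg fun hk => hh (hquot hk), mul_zero]

variable (X) in
/-- The regular representation `f ↦ (ρ_x(f))_x` as a linear map. -/
def regRepLinear : Cc X →ₗ[ℂ] ProdB X where
  toFun := regRep
  map_add' f g := BoundedFamilies.ext_eval fun x => EllTwo.ext_entry fun k l => by
    change EllTwo.entry (rho x (f + g)) k l = EllTwo.entry (rho x f + rho x g) k l
    simp only [EllTwo.entry_add, entry_rho, Submodule.coe_add, Pi.add_apply]
  map_smul' c f := BoundedFamilies.ext_eval fun x => EllTwo.ext_entry fun k l => by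
    change EllTwo.entry (rho x (c • f)) k l = EllTwo.entry (c • rho x f) k l
    simp only [EllTwo.entry_smul, entry_rho, Submodule.coe_smul, Pi.smul_apply, smul_eq_mul]

theorem norm_regRep_le_of_injOn (f : Cc X) (hs : Set.InjOn Arr.src (Function.support f.1))
    (ht : Set.InjOn Arr.tgt (Function.support f.1)) {C : ℝ} (hC : 0 ≤ C)
    (hf : ∀ γ, ‖f.1 γ‖ ≤ C) : ‖regRep f‖ ≤ C := by
  refine BoundedFamilies.norm_le hC fun x => ?_
  change ‖rho x f‖ ≤ C
  refine EllTwo.opNorm_le_of_monomial _ hC (fun k l hl l' hl' => ?_) (fun l k hk k' hk' => ?_)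
    fun k l => entry_rho x f k l ▸ hf _
  · simp only [Set.mem_ofPred, entry_rho] at hl hl'
    have h := hs hl hl' rfl
    obtain ⟨y, l⟩ := l
    obtain ⟨y', l'⟩ := l'
    obtain rfl : y = y' := congrArg Arr.tgt h
    simpa using h
  · simp only [Set.mem_ofPred, entry_rho] at hk hk'
    have h := ht hk hk' rfl
    obtain ⟨y, k⟩ := k
    obtain ⟨y', k'⟩ := k'
    obtain rfl : y = y' := congrArg Arr.src h
    have hinv : Groupoid.inv k ≫ l.2 = Groupoid.inv k' ≫ l.2 := by
      simpa only [Arr.mk.injEq, heq_eq_eq, true_and] using h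
    rw [Groupoid.invEquiv.injective ((cancel_mono l.2).1 hinv)]

end RegularRepresentations

section InverseHull

variable {S : Type*} [Monoid S] [IsLeftCancelMul S]

open LeftInverseHull

theorem LeftInverseHull.inv_apply_eq_some_iff {g : LeftInverseHull S} {t u : S} :
    g⁻¹.1 u = some t ↔ g.1 t = some u :=
  PEquiv.eq_some_iff _

namespace Idem

/-- The constructible ideal `X` of the idempotent `p_X`. -/
def ideal (p : Idem S) : Set S := {t | (p.1.1 t).isSome = true}

theorem apply_of_mem_ideal {p : Idem S} {t : S} (ht : t ∈ p.ideal) : p.1.1 t = some t := by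
  obtain ⟨u, hu⟩ := Option.isSome_iff_exists.1 ht
  rw [hu, eq_of_idem p.2 hu]

theorem ideal_mul (p q : Idem S) : (p * q).ideal = p.ideal ∩ q.ideal := by
  ext t
  exact (Bool.eq_iff_iff.1 ((SemiChar.point t).map_mul p q)).trans (Bool.and_eq_true_iff)

theorem ideal_injective : Function.Injective (ideal (S := S)) := by
  refine fun p q hpq => Idem.ext (LeftInverseHull.ext (PEquiv.ext fun t => ?_))
  by_cases hp : t ∈ p.ideal
  · rw [apply_of_mem_ideal hp, apply_of_mem_ideal (hpq ▸ hp : t ∈ q.ideal)]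
  · have hq : t ∉ q.ideal := hpq ▸ hp
    rw [Option.not_isSome_iff_eq_none.1 hp, Option.not_isSome_iff_eq_none.1 hq]

theorem mem_ideal_conj {g : LeftInverseHull S} {p : Idem S} {t : S} :
    t ∈ (conj g p).ideal ↔ ∃ u, g.1 t = some u ∧ u ∈ p.ideal := by
  change ((g.1 t).bind fun u => (p.1.1 u).bind g⁻¹.1).isSome = true ↔ _
  cases hg : g.1 t with
  | none => simp
  | some u =>
    rw [Option.bind_some]
    by_cases hu : u ∈ p.ideal
    · simp [apply_of_mem_ideal hu, inv_apply_eq_some_iff.2 hg, hu]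
    · simp [Option.not_isSome_iff_eq_none.1 hu, hu]

theorem mem_ideal_dom {g : LeftInverseHull S} {t : S} :
    t ∈ (dom g).ideal ↔ ∃ u, g.1 t = some u := by
  rw [← conj_one, mem_ideal_conj]
  exact exists_congr fun u => and_iff_left rfl

theorem ideal_dom_mul_subset (g h : LeftInverseHull S) : (dom (g * h)).ideal ⊆ (dom h).ideal :=
  fun t ht => by
    obtain ⟨u, hu⟩ := mem_ideal_dom.1 ht
    obtain ⟨v, hv, -⟩ := Option.bind_eq_some_iff.1 hu
    exact mem_ideal_dom.2 ⟨v, hv⟩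

theorem mul_eq_mul_iff_eqOn {g h : LeftInverseHull S} {p : Idem S} :
    g * p.1 = h * p.1 ↔ Set.EqOn g.1 h.1 p.ideal := by
  refine ⟨fun H t ht => ?_, fun H => LeftInverseHull.ext (PEquiv.ext fun t => ?_)⟩
  · simpa only [mul_apply, apply_of_mem_ideal ht, Option.bind_some] using
      congrArg (fun k : LeftInverseHull S => k.1 t) H
  · rw [mul_apply, mul_apply]
    by_cases ht : t ∈ p.ideal
    · rw [apply_of_mem_ideal ht, Option.bind_some, Option.bind_some, H ht]
    · rw [Option.not_isSome_iff_eq_none.1 ht, Option.bind_none, Option.bind_none]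

end Idem

namespace SemiChar

variable {χ ψ : SemiChar S} {g h k : LeftInverseHull S}

theorem map_mul_eq_true {p q : Idem S} (hp : χ p = true) (hq : χ q = true) : χ (p * q) = true := by
  rw [χ.map_mul, hp, hq, Bool.and_self]

theorem mono {p q : Idem S} (hpq : p.ideal ⊆ q.ideal) (hp : χ p = true) : χ q = true := by
  have hmul : p * q = p := Idem.ideal_injective <| by
    rw [Idem.ideal_mul, Set.inter_eq_left.2 hpq]
  have := χ.map_mul p q
  rwa [hmul, hp, Bool.true_and, eq_comm] at this

/-- The germs of `g` and `h` at `χ` agree, that is, `[g, χ] = [h, χ]`. Unlike the equality of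
arrows of the Paterson groupoid, this makes sense without knowing that `g` and `h` are defined at
`χ` and map it to the same semi-character. -/
def GermEq (χ : SemiChar S) (g h : LeftInverseHull S) : Prop :=
  ∃ p : Idem S, Set.EqOn g.1 h.1 p.ideal ∧ χ p = true

theorem mk_eq_mk_iff {g h : PreHom χ ψ} :
    (Quotient.mk (germSetoid χ ψ) g = Quotient.mk (germSetoid χ ψ) h) ↔ GermEq χ g.1 h.1 := by
  rw [Quotient.eq]
  exact exists_congr fun p => and_congr_left' Idem.mul_eq_mul_iff_eqOn

namespace GermEq

theorem refl (g : LeftInverseHull S) : GermEq χ g g := ⟨1, Set.eqOn_refl _ _, χ.map_one⟩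

theorem symm : GermEq χ g h → GermEq χ h g := fun ⟨p, hgh, hp⟩ => ⟨p, hgh.symm, hp⟩

theorem trans : GermEq χ g h → GermEq χ h k → GermEq χ g k := by
  rintro ⟨p, hgh, hp⟩ ⟨q, hhk, hq⟩
  refine ⟨p * q, ?_, map_mul_eq_true hp hq⟩
  rw [Idem.ideal_mul]
  exact (hgh.mono Set.inter_subset_left).trans (hhk.mono Set.inter_subset_right)

theorem mul_left (k : LeftInverseHull S) : GermEq χ g h → GermEq χ (k * g) (k * h) :=
  fun ⟨p, hgh, hp⟩ => ⟨p, fun t ht => by rw [mul_apply, mul_apply, hgh ht], hp⟩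

theorem mul_right (k : PreHom χ ψ) : GermEq ψ g h → GermEq χ (g * k.1) (h * k.1) := by
  rintro ⟨p, hgh, hp⟩
  refine ⟨Idem.conj k.1 p, fun t ht => ?_, by rw [← k.2.2, hp]⟩
  obtain ⟨u, hu, hup⟩ := Idem.mem_ideal_conj.1 ht
  rw [mul_apply, mul_apply, hu, Option.bind_some, Option.bind_some, hgh hup]

theorem inv_mul (hg : χ (Idem.dom g) = true) : GermEq χ (g⁻¹ * g) 1 :=
  ⟨Idem.dom g, fun _ => Idem.apply_of_mem_ideal, hg⟩

theorem mul_inv_iff (k : PreHom χ ψ) : GermEq ψ g (h * k.1⁻¹) ↔ GermEq χ (g * k.1) h := by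
  constructor
  · intro H
    have hk : GermEq χ (h * k.1⁻¹ * k.1) h := by
      simpa only [mul_assoc, mul_one] using (inv_mul k.2.1).mul_left h
    exact (H.mul_right k).trans hk
  · intro H
    have hinv : GermEq ψ (k.1 * k.1⁻¹) 1 := inv_mul k.inv.2.1
    have hk : GermEq ψ (g * k.1 * k.1⁻¹) g := by
      simpa only [mul_assoc, mul_one] using hinv.mul_left g
    exact hk.symm.trans (H.mul_right k.inv)

theorem map_conj (H : GermEq χ g h) (p : Idem S) : χ (Idem.conj g p) = χ (Idem.conj h p) := by
  suffices key : ∀ {g h}, GermEq χ g h → χ (Idem.conj g p) = true → χ (Idem.conj h p) = true from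
    Bool.eq_iff_iff.2 ⟨key H, key H.symm⟩
  rintro g h ⟨q, hgh, hq⟩ hg
  refine χ.mono (fun t ht => ?_) (map_mul_eq_true hg hq)
  rw [Idem.ideal_mul, Set.mem_inter_iff, Idem.mem_ideal_conj] at ht
  rw [Idem.mem_ideal_conj, ← hgh ht.2]
  exact ht.1

theorem map_dom (H : GermEq χ g h) : χ (Idem.dom g) = χ (Idem.dom h) := by
  rw [← Idem.conj_one, ← Idem.conj_one, H.map_conj]

theorem eq_inv_mul (hk : χ (Idem.dom k) = true) (H : GermEq χ (g * h) k) :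
    GermEq χ h (g⁻¹ * k) := by
  refine trans ⟨Idem.dom (g * h), fun t ht => ?_, H.map_dom.trans hk⟩ (H.mul_left g⁻¹)
  obtain ⟨u, hu⟩ := Idem.mem_ideal_dom.1 ht
  obtain ⟨v, hv, hvu⟩ := Option.bind_eq_some_iff.1 hu
  rw [mul_apply, hu, Option.bind_some, hv, inv_apply_eq_some_iff.2 hvu]

theorem mul_iff_inv_mul (hh : χ (Idem.dom h) = true) (hk : χ (Idem.dom k) = true) :
    GermEq χ (g * h) k ↔ GermEq χ (g⁻¹ * k) h := by
  refine ⟨fun H => (H.eq_inv_mul hk).symm, fun H => ?_⟩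
  simpa only [inv_inv] using (H.eq_inv_mul hh).symm

end GermEq

theorem germEq_point_one_of_iff {t : S} :
    GermEq (point (1 : S)) g (of t) ↔ g.1 1 = some t := by
  have ht : (of t).1 1 = some t := congrArg some (mul_one t)
  refine ⟨fun ⟨_, hp, h1⟩ => (hp h1).trans ht, fun hg => ⟨1, fun u _ => ?_, map_one _⟩⟩
  have := g.2.equivariant hg u
  rwa [one_mul] at this

end SemiChar

end InverseHull

section Topology

variable {S : Type*} [Monoid S] [IsLeftCancelMul S]

open LeftInverseHull

namespace SemiChar

variable {χ : SemiChar S}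

theorem isClosedEmbedding_toFun : IsClosedEmbedding (toFun (S := S)) := by
  refine ⟨⟨⟨rfl⟩, fun _ _ => SemiChar.ext⟩, ?_⟩
  have hclosed : IsClosed ((⋂ p : Idem S, ⋂ q : Idem S,
      {f : Idem S → Bool | f (p * q) = (f p && f q)}) ∩ {f | f 1 = true}) := by
    have hand : Continuous fun b : Bool × Bool => (b.1 && b.2) := continuous_of_discreteTopology
    refine (isClosed_iInter fun p => isClosed_iInter fun q => ?_).inter ?_
    · exact isClosed_eq (continuous_apply _) (hand.comp₂ (continuous_apply p) (continuous_apply q))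
    · exact isClosed_eq (continuous_apply _) continuous_const
  convert hclosed
  ext f
  simp only [Set.mem_range, Set.mem_inter_iff, Set.mem_iInter]
  exact ⟨fun ⟨χ, hχ⟩ => hχ ▸ ⟨χ.map_mul, χ.map_one⟩, fun ⟨hmul, hone⟩ => ⟨⟨f, hmul, 1, hone⟩, rfl⟩⟩

instance : CompactSpace (SemiChar S) := isClosedEmbedding_toFun.compactSpace

instance : T2Space (SemiChar S) := isClosedEmbedding_toFun.isEmbedding.t2Space

instance : TotallyDisconnectedSpace (SemiChar S) :=
  ⟨isClosedEmbedding_toFun.isEmbedding.isTotallyDisconnected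
    (isTotallyDisconnected_of_totallyDisconnectedSpace _)⟩

theorem isOpen_setOf_eq (p : Idem S) (b : Bool) : IsOpen {χ : SemiChar S | χ p = b} :=
  (isOpen_discrete {b}).preimage (continuous_eval p)

theorem eventually_eq {p : Idem S} {b : Bool} (h : χ p = b) : ∀ᶠ ψ : SemiChar S in 𝓝 χ, ψ p = b :=
  (isOpen_setOf_eq p b).mem_nhds h

theorem isOpen_setOf_germEq (g h : LeftInverseHull S) : IsOpen {χ : SemiChar S | GermEq χ g h} := by
  refine isOpen_iff_mem_nhds.2 fun χ ⟨p, hgh, hp⟩ => ?_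
  filter_upwards [eventually_eq hp] with ψ hψ using ⟨p, hgh, hψ⟩

theorem exists_basic_forall_eq (χ : SemiChar S) (F : Finset (Idem S)) :
    ∃ (p : Idem S) (N : Finset (Idem S)), (χ p = true ∧ ∀ q ∈ N, χ q = false) ∧
      ∀ ψ : SemiChar S, ψ p = true → (∀ q ∈ N, ψ q = false) → ∀ r ∈ F, ψ r = χ r := by
  classical
  induction F using Finset.induction_on with
  | empty => exact ⟨1, ∅, by simp [χ.map_one]⟩
  | insert r F _ ih =>
    obtain ⟨p, N, ⟨hp, hN⟩, H⟩ := ih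
    cases hr : χ r with
    | true =>
      refine ⟨r * p, N, ⟨map_mul_eq_true hr hp, hN⟩, fun ψ hψ hψN => ?_⟩
      rw [ψ.map_mul, Bool.and_eq_true] at hψ
      exact Finset.forall_mem_insert _ _ _ |>.2 ⟨hψ.1.trans hr.symm, H ψ hψ.2 hψN⟩
    | false =>
      refine ⟨p, insert r N, ⟨hp, Finset.forall_mem_insert _ _ _ |>.2 ⟨hr, hN⟩⟩, fun ψ hψ hψN => ?_⟩
      obtain ⟨hψr, hψN⟩ := Finset.forall_mem_insert _ _ _ |>.1 hψN
      exact Finset.forall_mem_insert _ _ _ |>.2 ⟨hψr.trans hr.symm, H ψ hψ hψN⟩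

theorem exists_basic_of_mem_nhds {U : Set (SemiChar S)} (hU : U ∈ 𝓝 χ) :
    ∃ (p : Idem S) (N : Finset (Idem S)), (χ p = true ∧ ∀ q ∈ N, χ q = false) ∧
      ∀ ψ : SemiChar S, ψ p = true → (∀ q ∈ N, ψ q = false) → ψ ∈ U := by
  rw [isClosedEmbedding_toFun.isInducing.nhds_eq_comap, nhds_pi] at hU
  obtain ⟨V, hV, hVU⟩ := hU
  obtain ⟨F, t, ht, hF⟩ := Filter.mem_pi'.1 hV
  obtain ⟨p, N, hχ, H⟩ := χ.exists_basic_forall_eq F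
  refine ⟨p, N, hχ, fun ψ hψ hψN => hVU (hF fun r hr => ?_)⟩
  rw [H ψ hψ hψN r hr]
  exact mem_of_mem_nhds (ht r)

/-- The semi-character `χ(g⁻¹ · g)`, the range of `[g, χ]`. -/
def translate (g : LeftInverseHull S) (χ : SemiChar S) (hg : χ (Idem.dom g) = true) :
    SemiChar S where
  toFun p := χ (Idem.conj g p)
  map_mul p q := by rw [Idem.conj_mul, χ.map_mul]
  ne_zero := ⟨1, by rw [Idem.conj_one, hg]⟩

theorem mem_basicSet_iff {ψ : SemiChar S} (k : PreHom χ ψ) (g : LeftInverseHull S)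
    (U : Set (SemiChar S)) :
    (⟨χ, ψ, Quotient.mk (germSetoid χ ψ) k⟩ : Arr (SemiChar S)) ∈ basicSet g U ↔
      χ ∈ U ∧ GermEq χ g k.1 := by
  refine and_congr_right fun _ => ⟨fun ⟨hg, h⟩ => (mk_eq_mk_iff.1 h).symm, fun H => ?_⟩
  exact ⟨⟨H.map_dom.trans k.2.1, fun p => (k.2.2 p).trans (H.map_conj p).symm⟩,
    mk_eq_mk_iff.2 H.symm⟩

theorem isOpen_basicSet (g : LeftInverseHull S) {U : Set (SemiChar S)} (hU : IsOpen U)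
    (hUg : U ⊆ {χ | χ (Idem.dom g) = true}) : IsOpen (basicSet g U) :=
  TopologicalSpace.isOpen_generateFrom_of_mem ⟨g, U, hU, hUg, rfl⟩

theorem continuous_src : Continuous (Arr.src : Arr (SemiChar S) → SemiChar S) := by
  refine continuous_def.2 fun U hU => isOpen_iff_forall_mem_open.2 ?_
  rintro ⟨χ, ψ, ⟨k⟩⟩ hχ
  exact ⟨basicSet k.1 (U ∩ {χ | χ (Idem.dom k.1) = true}), fun γ hγ => hγ.1.1,
    isOpen_basicSet _ (hU.inter (isOpen_setOf_eq _ _)) Set.inter_subset_right,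
    (mem_basicSet_iff k _ _).2 ⟨⟨hχ, k.2.1⟩, .refl _⟩⟩

end SemiChar

open SemiChar

theorem Omega_eq_closure_range_point : Omega S = closure (Set.range (point (S := S))) := by
  refine congrArg closure (Set.ext fun χ => ⟨fun ⟨f⟩ => ?_, ?_⟩)
  · obtain ⟨s, hs⟩ := toFiber_bijective.2 (⟨⟨χ, subset_closure ⟨f⟩⟩, f⟩ : SourceFiber (chiE S))
    exact ⟨s, congrArg (fun k : SourceFiber (chiE S) => k.1.1) hs⟩
  · rintro ⟨s, rfl⟩
    exact ⟨translationGerm s⟩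

theorem exists_point_of_mem_Omega {χ : SemiChar S} (hχ : χ ∈ Omega S) {P : SemiChar S → Prop}
    (hP : ∀ᶠ ψ in 𝓝 χ, P ψ) : ∃ s, P (point s) := by
  rw [Omega_eq_closure_range_point] at hχ
  obtain ⟨_, hs, s, rfl⟩ := mem_closure_iff_nhds.1 hχ _ hP
  exact ⟨s, hs⟩

theorem translate_mem_Omega {g : LeftInverseHull S} {χ : SemiChar S}
    (hg : χ (Idem.dom g) = true) (hχ : χ ∈ Omega S) : translate g χ hg ∈ Omega S := by
  rw [Omega_eq_closure_range_point, mem_closure_iff_nhds]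
  intro U hU
  obtain ⟨p, N, ⟨hp, hN⟩, hsub⟩ := exists_basic_of_mem_nhds hU
  have hnear : ∀ᶠ ψ in 𝓝 χ, ψ (Idem.dom g) = true ∧ ψ (Idem.conj g p) = true ∧
      ∀ q ∈ N, ψ (Idem.conj g q) = false :=
    (eventually_eq hg).and <| (eventually_eq (χ := χ) hp).and <|
      (Filter.eventually_all_finset N).2 fun q hq => eventually_eq (χ := χ) (hN q hq)
  obtain ⟨s, hsg, hsp, hsN⟩ := exists_point_of_mem_Omega hχ hnear
  obtain ⟨u, hu⟩ := Idem.mem_ideal_dom.1 hsg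
  have hconj : ∀ q, point u q = point s (Idem.conj g q) := fun q => Bool.eq_iff_iff.2 <| by
    refine Iff.trans ?_ Idem.mem_ideal_conj.symm
    simp only [hu, Option.some.injEq, exists_eq_left']
    exact Iff.rfl
  exact ⟨point u, hsub _ ((hconj p).trans hsp) fun q hq => (hconj q).trans (hsN q hq), u, rfl⟩

instance : CompactSpace (Omega S) :=
  isCompact_iff_compactSpace.1
    (isClosed_closure (s := {χ | Nonempty (point (1 : S) ⟶ χ)})).isCompact

end Topology

section StrongRegularity

variable {S : Type*} [Monoid S] [IsLeftCancelMul S]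

open LeftInverseHull SemiChar

theorem iUnion_equivFin_symm {α β : Type*} (N : Finset α) (f : α → Set β) :
    ⋃ i, f (N.equivFin.symm i) = ⋃ a ∈ N, f a :=
  (N.equivFin.symm.surjective.iUnion_comp fun a : N => f a).trans iSup_subtype

theorem LeftInverseHull.inv_mul_apply_eq_some_self_iff {g k : LeftInverseHull S} {t : S} :
    (k⁻¹ * g).1 t = some t ↔ g.1 t = k.1 t ∧ t ∈ (Idem.dom k).ideal := by
  simp only [mul_apply, Option.bind_eq_some_iff, inv_apply_eq_some_iff, Idem.mem_ideal_dom]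
  constructor
  · rintro ⟨u, hg, hk⟩
    exact ⟨hg.trans hk.symm, u, hk⟩
  · rintro ⟨hgk, u, hk⟩
    exact ⟨u, hgk.trans hk, hk⟩

namespace Idem

open scoped Classical in
theorem ofSet_ideal (p : Idem S) : PEquiv.ofSet p.ideal = p.1.1 := by
  refine PEquiv.ext fun t => ?_
  by_cases ht : t ∈ p.ideal
  · exact (if_pos ht).trans (apply_of_mem_ideal ht).symm
  · exact (if_neg ht).trans (Option.not_isSome_iff_eq_none.1 ht).symm

theorem ideal_mem_constructibleIdeals (p : Idem S) : p.ideal ∈ constructibleIdeals S :=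
  (congrArg InLeftInverseHull p.ofSet_ideal).mpr p.1.2

theorem exists_ideal_eq (X : constructibleIdeals S) :
    ∃ p : Idem S, p.1 = idemOf X ∧ p.ideal = X := by
  classical
  have hX : ∀ t ∈ X.1, (idemOf X).1 t = some t := fun t ht => if_pos ht
  have hXc : ∀ t ∉ X.1, (idemOf X).1 t = none := fun t ht => if_neg ht
  refine ⟨⟨idemOf X, LeftInverseHull.ext (PEquiv.ext fun t => ?_)⟩, rfl, Set.ext fun t => ?_⟩ <;>
    by_cases ht : t ∈ X.1
  · rw [mul_apply, hX t ht, Option.bind_some, hX t ht]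
  · rw [mul_apply, hXc t ht, Option.bind_none]
  · exact iff_of_true (Option.isSome_iff_exists.2 ⟨t, hX t ht⟩) ht
  · exact iff_of_false (Option.not_isSome_iff_eq_none.2 (hXc t ht)) ht

end Idem

namespace StronglyCStarRegular

theorem exists_finite_cover (hS : StronglyCStarRegular S) {p : Idem S} {N : Finset (Idem S)}
    {B : Finset (LeftInverseHull S)} (hne : (p.ideal \ ⋃ q ∈ N, q.ideal).Nonempty)
    (hB : p.ideal \ ⋃ q ∈ N, q.ideal ⊆ ⋃ g ∈ B, {s | g.1 s = some s}) :
    ∃ Y : Set (Idem S), Y.Finite ∧ p.ideal \ ⋃ q ∈ N, q.ideal ⊆ ⋃ y ∈ Y, y.ideal ∧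
      ∀ y ∈ Y, ∃ g ∈ B, Set.EqOn g.1 (1 : LeftInverseHull S).1 y.ideal := by
  rw [← iUnion_equivFin_symm N fun q => q.ideal] at hne hB ⊢
  rw [← iUnion_equivFin_symm B fun g => {s | g.1 s = some s}] at hB
  obtain ⟨l, Y, k, hY, hk⟩ := hS _ _ _ ⟨p.ideal, p.ideal_mem_constructibleIdeals⟩
    (fun i => ⟨_, (N.equivFin.symm i).1.ideal_mem_constructibleIdeals⟩) hne hB
  choose y hyY hy using fun j => Idem.exists_ideal_eq (Y j)
  refine ⟨Set.range y, Set.finite_range y, ?_, ?_⟩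
  · simpa only [Set.biUnion_range, hy] using hY
  · rintro _ ⟨j, rfl⟩
    refine ⟨_, (B.equivFin.symm (k j)).2, Idem.mul_eq_mul_iff_eqOn.1 ?_⟩
    rw [hyY, hk, one_mul]

/-- If finitely many elements of `I_ℓ(S)` fixed all the points near `χ`, then by strong regularity
finitely many constructible ideals, on each of which one of these elements is the identity, would
cover the points near `χ`, and one of the ideals would belong to `χ`. -/
theorem exists_point (hS : StronglyCStarRegular S) {χ : SemiChar S} (hχ : χ ∈ Omega S)
    {P : SemiChar S → Prop} (hP : ∀ᶠ ψ in 𝓝 χ, P ψ) (B : Finset (LeftInverseHull S))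
    (hB : ∀ g ∈ B, ¬ GermEq χ g 1) : ∃ s, P (point s) ∧ ∀ g ∈ B, g.1 s ≠ some s := by
  by_contra! hc
  obtain ⟨p, N, ⟨hp, hN⟩, hpN⟩ := exists_basic_of_mem_nhds hP
  have hnear : ∀ᶠ ψ : SemiChar S in 𝓝 χ, ψ p = true ∧ ∀ q ∈ N, ψ q = false :=
    (eventually_eq hp).and ((Filter.eventually_all_finset N).2 fun q hq => eventually_eq (hN q hq))
  have hmem : ∀ s, s ∈ p.ideal \ ⋃ q ∈ N, q.ideal ↔
      point s p = true ∧ ∀ q ∈ N, point s q = false := fun s => by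
    refine and_congr Iff.rfl ?_
    simp only [Set.mem_iUnion, not_exists]
    exact forall₂_congr fun q _ => Bool.not_eq_true _ ▸ Iff.rfl
  obtain ⟨Y, hYfin, hY, hYB⟩ := hS.exists_finite_cover (p := p) (N := N) (B := B)
    ((exists_point_of_mem_Omega hχ hnear).imp fun s => (hmem s).2) fun s hs => by
      obtain ⟨hsp, hsN⟩ := (hmem s).1 hs
      exact Set.mem_iUnion₂.2 (bex_def.2 (hc s (hpN _ hsp hsN)))
  have hχY : ∀ y ∈ Y, χ y = false := fun y hy => Bool.eq_false_iff.2 fun hχy => by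
    obtain ⟨g, hg, hgy⟩ := hYB y hy
    exact hB g hg ⟨y, hgy, hχy⟩
  obtain ⟨s, hs, hsY⟩ := exists_point_of_mem_Omega hχ
    (hnear.and ((Filter.eventually_all_finite hYfin).2 fun y hy => eventually_eq (hχY y hy)))
  obtain ⟨y, hy, hsy⟩ := Set.mem_iUnion₂.1 (hY ((hmem s).2 hs))
  exact Bool.eq_false_iff.1 (hsY y hy) hsy

theorem exists_separating (hS : StronglyCStarRegular S) {χ : SemiChar S} (hχ : χ ∈ Omega S)
    (t : Finset (LeftInverseHull S × LeftInverseHull S))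
    (ht : ∀ x ∈ t, χ (Idem.dom x.2) = true) :
    ∃ s : S, ∀ x ∈ t, s ∈ (Idem.dom x.2).ideal ∧ (x.1.1 s = x.2.1 s ↔ GermEq χ x.1 x.2) := by
  classical
  have hnear : ∀ᶠ ψ in 𝓝 χ, ∀ x ∈ t, ψ (Idem.dom x.2) = true ∧
      (GermEq χ x.1 x.2 → GermEq ψ x.1 x.2) := by
    refine (Filter.eventually_all_finset t).2 fun x hx => (eventually_eq (ht x hx)).and ?_
    by_cases hgerm : GermEq χ x.1 x.2
    · filter_upwards [(isOpen_setOf_germEq x.1 x.2).mem_nhds hgerm] with ψ hψ _ using hψ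
    · exact .of_forall fun ψ h => absurd h hgerm
  obtain ⟨s, hs, hsB⟩ := hS.exists_point hχ hnear
    ((t.filter fun x => ¬ GermEq χ x.1 x.2).image fun x => x.2⁻¹ * x.1) <| by
      refine Finset.forall_mem_image.2 fun x hx ⟨p, hp, hχp⟩ => ?_
      exact (Finset.mem_filter.1 hx).2
        ⟨p, fun u hu => (inv_mul_apply_eq_some_self_iff.1 (hp hu)).1, hχp⟩
  refine ⟨s, fun x hx => ⟨(hs x hx).1, fun heq => ?_, fun hgerm => ?_⟩⟩
  · by_contra hgerm
    exact hsB _ (Finset.mem_image_of_mem _ (Finset.mem_filter.2 ⟨hx, hgerm⟩))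
      (inv_mul_apply_eq_some_self_iff.2 ⟨heq, (hs x hx).1⟩)
  · obtain ⟨p, hp, hsp⟩ := (hs x hx).2 hgerm
    exact hp hsp

end StronglyCStarRegular

end StrongRegularity

section Bisections

variable {S : Type*} [Monoid S] [IsLeftCancelMul S]

open LeftInverseHull SemiChar

theorem SemiChar.germEq_mul_idem_iff {χ : SemiChar S} {g k : LeftInverseHull S} {p : Idem S}
    (hk : χ (Idem.dom k) = true) : GermEq χ (g * p.1) k ↔ GermEq χ g k ∧ χ p = true := by
  have hgp : χ p = true → GermEq χ (g * p.1) g := fun hp =>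
    ⟨p, fun t ht => by rw [mul_apply, Idem.apply_of_mem_ideal ht, Option.bind_some], hp⟩
  refine ⟨fun H => ?_, fun ⟨H, hp⟩ => (hgp hp).trans H⟩
  have hp : χ p = true := χ.mono (fun t ht => ?_) (H.map_dom.trans hk)
  · exact ⟨(hgp hp).symm.trans H, hp⟩
  · obtain ⟨u, hu⟩ := Idem.mem_ideal_dom.1 ht
    obtain ⟨v, hv, -⟩ := Option.bind_eq_some_iff.1 hu
    exact Option.isSome_iff_exists.2 ⟨v, hv⟩

namespace GroupoidP

/-- The source of an arrow as a point of `Ω(S)`. -/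
def source (γ : Arr (GroupoidP S)) : Omega S := ⟨γ.src.1, γ.src.2⟩

theorem continuous_source : Continuous (source (S := S)) :=
  (continuous_src.comp (continuous_induced_dom (f := Reduction.incl (Omega S)))).subtype_mk
    fun γ => γ.src.2

/-- The set of the `χ ∈ Ω(S)` with `χ(g⁻¹g) = 1`. -/
def domSet (g : LeftInverseHull S) : Set (Omega S) := {χ | χ.1 (Idem.dom g) = true}

theorem isClosed_domSet (g : LeftInverseHull S) : IsClosed (domSet g) :=
  isClosed_eq ((continuous_eval _).comp continuous_subtype_val) continuous_const

/-- The compact open bisection of the arrows `[g, χ]`. -/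
def bisection (g : LeftInverseHull S) : Set (Arr (GroupoidP S)) :=
  Reduction.incl (Omega S) ⁻¹' basicSet g {χ | χ (Idem.dom g) = true}

theorem mk_mem_bisection_iff {x y : GroupoidP S} (k : PreHom x.1 y.1) (g : LeftInverseHull S) :
    (⟨x, y, Quotient.mk (germSetoid x.1 y.1) k⟩ : Arr (GroupoidP S)) ∈ bisection g ↔
      GermEq x.1 g k.1 :=
  (mem_basicSet_iff k g _).trans (and_iff_right_of_imp fun H => H.map_dom.trans k.2.1)

theorem isOpen_bisection (g : LeftInverseHull S) : IsOpen (bisection g) :=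
  (isOpen_basicSet g (isOpen_setOf_eq _ _) subset_rfl).preimage continuous_induced_dom

/-- The arrow `[g, χ]` of `𝒢_P(S)`. -/
def germArr (g : LeftInverseHull S) (χ : domSet g) : Arr (GroupoidP S) where
  src := ⟨χ.1.1, χ.1.2⟩
  tgt := ⟨translate g χ.1.1 χ.2, translate_mem_Omega χ.2 χ.1.2⟩
  hom := Quotient.mk (germSetoid χ.1.1 (translate g χ.1.1 χ.2)) ⟨g, χ.2, fun _ => rfl⟩

theorem germArr_source {g : LeftInverseHull S} {γ : Arr (GroupoidP S)} (hγ : γ ∈ bisection g) :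
    germArr g ⟨source γ, hγ.1⟩ = γ := by
  obtain ⟨⟨χ, _⟩, ⟨ψ, _⟩, f⟩ := γ
  obtain ⟨hd, hg, hf⟩ := hγ
  change χ (Idem.dom g) = true at hd
  obtain rfl : translate g χ hd = ψ := SemiChar.ext (funext fun p => (hg.2 p).symm)
  exact congrArg (Arr.mk _ _) hf.symm

theorem range_germArr (g : LeftInverseHull S) : Set.range (germArr g) = bisection g := by
  refine Set.Subset.antisymm ?_ fun γ hγ => ⟨_, germArr_source hγ⟩
  rintro _ ⟨χ, rfl⟩
  exact ⟨χ.2, ⟨χ.2, fun _ => rfl⟩, rfl⟩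

theorem continuous_germArr (g : LeftInverseHull S) : Continuous (germArr g) := by
  refine continuous_induced_rng.2 (continuous_generateFrom_iff.2 ?_)
  rintro _ ⟨h, U, hU, -, rfl⟩
  have hpre : Reduction.incl (Omega S) ∘ germArr g ⁻¹' basicSet h U =
      (fun χ : domSet g => χ.1.1) ⁻¹' (U ∩ {χ | GermEq χ h g}) :=
    Set.ext fun χ => mem_basicSet_iff _ h U
  rw [hpre]
  exact (hU.inter (isOpen_setOf_germEq h g)).preimage
    (continuous_subtype_val.comp continuous_subtype_val)

theorem isCompact_bisection (g : LeftInverseHull S) : IsCompact (bisection g) := by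
  have : CompactSpace (domSet g) := isCompact_iff_compactSpace.1 (isClosed_domSet g).isCompact
  exact range_germArr g ▸ isCompact_range (continuous_germArr g)

theorem source_injOn (g : LeftInverseHull S) : Set.InjOn source (bisection g) := by
  intro γ hγ δ hδ h
  rw [← germArr_source hγ, ← germArr_source hδ]
  exact congrArg (germArr g) (Subtype.ext h)

theorem src_injOn (g : LeftInverseHull S) : Set.InjOn Arr.src (bisection g) := fun _ hγ _ hδ h =>
  source_injOn g hγ hδ (Subtype.ext (congrArg Reduction.val h))

theorem tgt_injOn (g : LeftInverseHull S) : Set.InjOn Arr.tgt (bisection g) := by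
  rw [← range_germArr]
  rintro _ ⟨χ, rfl⟩ _ ⟨χ', rfl⟩ h
  refine congrArg (germArr g) (Subtype.ext (Subtype.ext (SemiChar.ext (funext fun p => ?_))))
  have htgt : translate g χ.1.1 χ.2 = translate g χ'.1.1 χ'.2 := congrArg Reduction.val h
  have hsrc : ∀ ξ : domSet g, ξ.1.1 p = translate g ξ.1.1 ξ.2 (Idem.conj g⁻¹ p) := fun ξ =>
    PreHom.src_eq ⟨g, ξ.2, fun _ => rfl⟩ p
  exact (hsrc χ).trans ((congrArg (fun ξ : SemiChar S => ξ _) htgt).trans (hsrc χ').symm)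

instance (g : LeftInverseHull S) : T2Space (bisection g) :=
  T2Space.of_injective_continuous (f := fun γ : bisection g => source γ.1)
    (fun γ δ h => Subtype.ext (source_injOn g γ.2 δ.2 h))
    (continuous_source.comp continuous_subtype_val)

theorem bisection_mul_idem (g : LeftInverseHull S) (p : Idem S) :
    bisection (g * p.1) = bisection g ∩ {γ | γ.src.1 p = true} := by
  ext ⟨x, y, ⟨k⟩⟩
  exact (mk_mem_bisection_iff k _).trans <| (germEq_mul_idem_iff k.2.1).trans <|
    and_congr_left' (mk_mem_bisection_iff k g).symm

/-- The function that is `φ ∘ source` on the bisection of `g`, and zero elsewhere. -/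
def sourcePullback (g : LeftInverseHull S) : C(Omega S, ℂ) →ₗ[ℂ] Cc (GroupoidP S) where
  toFun φ := ⟨(bisection g).indicator (φ ∘ source), by
    refine Submodule.subset_span ⟨bisection g, isOpen_bisection g, inferInstance, ?_,
      bisection g, subset_rfl, isCompact_bisection g, fun γ hγ => Set.indicator_of_notMem hγ _⟩
    exact (φ.continuous.comp continuous_source).continuousOn.congr
      fun γ hγ => Set.indicator_of_mem hγ _⟩
  map_add' φ ψ := Subtype.ext (Set.indicator_add _ _ _)
  map_smul' c φ := Subtype.ext (Set.indicator_const_smul (bisection g) c (φ ∘ source))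

theorem norm_regRep_sourcePullback_le (g : LeftInverseHull S) (φ : C(Omega S, ℂ)) :
    ‖regRep (sourcePullback g φ)‖ ≤ ‖φ‖ :=
  have hsupp : Function.support (sourcePullback g φ).1 ⊆ bisection g :=
    Set.support_indicator_subset (f := φ ∘ source)
  norm_regRep_le_of_injOn _ ((src_injOn g).mono hsupp) ((tgt_injOn g).mono hsupp) (norm_nonneg _)
    fun γ => (norm_indicator_le_norm_self (φ ∘ source) γ).trans (φ.norm_coe_le_norm _)

/-- The characteristic function of the bisection of `g`. -/
def bisectionIndicator (g : LeftInverseHull S) : Cc (GroupoidP S) := sourcePullback g 1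

/-- The continuous function `χ ↦ χ(p)` on `Ω(S)`. -/
def evalAt (p : Idem S) : C(Omega S, ℂ) where
  toFun χ := if χ.1 p then 1 else 0
  continuous_toFun :=
    (continuous_of_discreteTopology (f := fun b : Bool => (if b then 1 else 0 : ℂ))).comp
      ((continuous_eval p).comp continuous_subtype_val)

theorem sourcePullback_evalAt (g : LeftInverseHull S) (p : Idem S) :
    sourcePullback g (evalAt p) = bisectionIndicator (g * p.1) := by
  have hp : evalAt p ∘ source = {γ : Arr (GroupoidP S) | γ.src.1 p = true}.indicator 1 := by
    classical
    funext γ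
    rw [Set.indicator_apply]
    exact if_congr Iff.rfl rfl rfl
  refine Subtype.ext ?_
  change (bisection g).indicator (evalAt p ∘ source) = (bisection (g * p.1)).indicator 1
  rw [hp, Set.indicator_indicator, bisection_mul_idem]

variable (S) in
/-- The functions `evalAt p`, which are closed under multiplication since each `χ` is a semigroup
homomorphism. -/
def evalSubmonoid : Submonoid C(Omega S, ℂ) where
  carrier := Set.range evalAt
  one_mem' := ⟨1, ContinuousMap.ext fun χ => if_pos χ.1.map_one⟩
  mul_mem' := by
    rintro _ _ ⟨p, rfl⟩ ⟨q, rfl⟩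
    refine ⟨p * q, ContinuousMap.ext fun χ => ?_⟩
    change (if χ.1 (p * q) then 1 else 0) =
      (if χ.1 p then 1 else 0) * (if χ.1 q then 1 else 0 : ℂ)
    rw [χ.1.map_mul, ite_zero_mul_ite_zero, one_mul]
    simp only [Bool.and_eq_true]

theorem star_evalAt (p : Idem S) : star (evalAt p) = evalAt p := ContinuousMap.ext fun χ => by
  change star (if χ.1 p then 1 else 0 : ℂ) = if χ.1 p then 1 else 0
  rw [apply_ite star, star_one, star_zero]

theorem mem_closure_span_evalAt (φ : C(Omega S, ℂ)) :
    φ ∈ closure (Submodule.span ℂ (Set.range (evalAt (S := S))) : Set C(Omega S, ℂ)) := by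
  have hspan : (StarAlgebra.adjoin ℂ (Set.range (evalAt (S := S))) : Set C(Omega S, ℂ)) =
      Submodule.span ℂ (Set.range (evalAt (S := S))) := by
    have hstar : star (Set.range (evalAt (S := S))) = Set.range evalAt := by
      rw [← Set.image_star, ← Set.range_comp]
      exact congrArg Set.range (funext star_evalAt)
    have := StarAlgebra.adjoin_eq_span (R := ℂ) (Set.range (evalAt (S := S)))
    rw [hstar, Set.union_self] at this
    exact congrArg SetLike.coe (this.trans
      (congrArg (fun s : Submonoid _ => Submodule.span ℂ (s : Set C(Omega S, ℂ)))
        (evalSubmonoid S).closure_eq))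
  have htop := ContinuousMap.starSubalgebra_topologicalClosure_eq_top_of_separatesPoints
    (StarAlgebra.adjoin ℂ (Set.range (evalAt (S := S)))) fun χ ψ hχψ => by
      obtain ⟨p, hp⟩ : ∃ p, χ.1 p ≠ ψ.1 p := by
        by_contra! heq
        exact hχψ (Subtype.ext (SemiChar.ext (funext heq)))
      refine ⟨evalAt p, ⟨evalAt p, StarAlgebra.subset_adjoin ℂ _ ⟨p, rfl⟩, rfl⟩, fun heq => hp ?_⟩
      change (if χ.1 p then 1 else 0 : ℂ) = if ψ.1 p then 1 else 0 at heq
      cases h1 : χ.1 p <;> cases h2 : ψ.1 p <;> simp_all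
  rw [← hspan, ← StarSubalgebra.topologicalClosure_coe, htop]
  trivial

variable (S) in
/-- The span of the operator families `(ρ_χ(1_B))_χ`, `B` ranging over the bisections of the
`g ∈ I_ℓ(S)`. -/
def indicatorSpan : Submodule ℂ (ProdB (GroupoidP S)) :=
  Submodule.span ℂ (Set.range fun g => regRep (bisectionIndicator g))

theorem regRep_sourcePullback_mem_closure (g : LeftInverseHull S) (φ : C(Omega S, ℂ)) :
    regRep (sourcePullback g φ) ∈ (indicatorSpan S).topologicalClosure := by
  let L : C(Omega S, ℂ) →L[ℂ] ProdB (GroupoidP S) :=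
    (regRepLinear (GroupoidP S) ∘ₗ sourcePullback g).mkContinuous 1 fun φ =>
      (norm_regRep_sourcePullback_le g φ).trans_eq (one_mul _).symm
  have hL : Submodule.span ℂ (Set.range evalAt) ≤ (indicatorSpan S).comap L.toLinearMap := by
    refine Submodule.span_le.2 ?_
    rintro _ ⟨p, rfl⟩
    exact Submodule.subset_span ⟨g * p.1, congrArg regRep (sourcePullback_evalAt g p).symm⟩
  exact map_mem_closure (f := L) L.continuous (mem_closure_span_evalAt φ) hL

end GroupoidP

end Bisections

section CompactOpenPartition

variable {Y E : Type*} [TopologicalSpace Y]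

theorem isOpen_diff_of_isCompact {V W : Set Y} (hV : IsOpen V) [T2Space V] (hW : IsCompact W)
    (hWV : W ⊆ V) : IsOpen (V \ W) := by
  have hW' : IsCompact (Subtype.val ⁻¹' W : Set V) := by
    rwa [Subtype.isCompact_iff, Subtype.image_preimage_coe, Set.inter_eq_right.2 hWV]
  have hopen := hV.isOpenMap_subtype_val _ hW'.isClosed.isOpen_compl
  rwa [← Set.preimage_compl, Subtype.image_preimage_coe] at hopen

theorem continuousOn_indicator_compl [Zero E] [TopologicalSpace E] {V W : Set Y} (hV : IsOpen V)
    [T2Space V] (hWo : IsOpen W) (hW : IsCompact W) (hWV : W ⊆ V) {f : Y → E}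
    (hf : ContinuousOn f V) : ContinuousOn (Wᶜ.indicator f) V := by
  refine continuousOn_of_forall_continuousAt fun y hy => ?_
  by_cases hyW : y ∈ W
  · refine (continuousAt_const (y := (0 : E))).congr ?_
    filter_upwards [hWo.mem_nhds hyW] with z hz
    exact (Set.indicator_of_notMem (not_not_intro hz) f).symm
  · refine (hf.continuousAt (hV.mem_nhds hy)).congr ?_
    filter_upwards [(isOpen_diff_of_isCompact hV hW hWV).mem_nhds ⟨hy, hyW⟩] with z hz
    exact (Set.indicator_of_mem (s := Wᶜ) hz.2 f).symm

theorem mem_of_forall_indicator_mem [AddMonoid E] [TopologicalSpace E] {V : Set Y} (hV : IsOpen V)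
    [T2Space V] {M : AddSubmonoid (Y → E)} {𝒯 : Set (Set Y)} (h𝒯 : 𝒯.Finite)
    (hsub : ∀ W ∈ 𝒯, IsOpen W ∧ IsCompact W ∧ W ⊆ V)
    (hM : ∀ W ∈ 𝒯, ∀ f : Y → E, ContinuousOn f V → W.indicator f ∈ M) {f : Y → E}
    (hf : ContinuousOn f V) (hsupp : ∀ y ∉ ⋃₀ 𝒯, f y = 0) : f ∈ M := by
  induction 𝒯, h𝒯 using Set.Finite.induction_on generalizing f with
  | empty => exact (funext fun y => hsupp y (by simp) : f = 0) ▸ M.zero_mem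
  | @insert W 𝒯 _ _ ih =>
    obtain ⟨hWo, hW, hWV⟩ := hsub W (Set.mem_insert W 𝒯)
    rw [← Set.indicator_self_add_compl W f]
    refine M.add_mem (hM W (Set.mem_insert W 𝒯) f hf)
      (ih (fun W' hW' => hsub W' (Set.mem_insert_of_mem W hW'))
        (fun W' hW' => hM W' (Set.mem_insert_of_mem W hW'))
        (continuousOn_indicator_compl hV hWo hW hWV hf) fun y hy => ?_)
    refine Set.indicator_apply_eq_zero.2 fun hyW => hsupp y ?_
    rw [Set.sUnion_insert]
    exact fun hy' => hy'.elim hyW hy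

theorem mem_of_continuousOn_of_compact_support [AddMonoid E] [TopologicalSpace E]
    {𝓑 : Set (Set Y)} (h𝓑 : TopologicalSpace.IsTopologicalBasis 𝓑)
    (hcompact : ∀ W ∈ 𝓑, IsCompact W) {V : Set Y} (hV : IsOpen V) [T2Space V]
    {M : AddSubmonoid (Y → E)}
    (hM : ∀ W ∈ 𝓑, W ⊆ V → ∀ f : Y → E, ContinuousOn f V → W.indicator f ∈ M) {K : Set Y}
    (hK : IsCompact K) (hKV : K ⊆ V) {f : Y → E} (hf : ContinuousOn f V)
    (hsupp : ∀ y ∉ K, f y = 0) : f ∈ M := by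
  choose! W hW using fun y (hy : y ∈ V) => h𝓑.exists_subset_of_mem_open hy hV
  obtain ⟨t, htK, ht⟩ := hK.elim_nhds_subcover W fun y hy =>
    (h𝓑.isOpen (hW y (hKV hy)).1).mem_nhds (hW y (hKV hy)).2.1
  refine mem_of_forall_indicator_mem hV (t.finite_toSet.image W) ?_ ?_ hf fun y hy =>
    hsupp y fun hyK => hy ?_
  · rintro _ ⟨y, hy, rfl⟩
    have hWy := hW y (hKV (htK y hy))
    exact ⟨h𝓑.isOpen hWy.1, hcompact _ hWy.1, hWy.2.2⟩
  · rintro _ ⟨y, hy, rfl⟩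
    have hWy := hW y (hKV (htK y hy))
    exact hM _ hWy.1 hWy.2.2
  · rw [Set.sUnion_image]
    exact ht hyK

end CompactOpenPartition

section Density

variable {S : Type*} [Monoid S] [IsLeftCancelMul S]

open LeftInverseHull SemiChar

namespace GroupoidP

variable (S) in
/-- The sets of the arrows `[g, χ]` with `χ ∈ C`, for `g ∈ I_ℓ(S)` and `C ⊆ Ω(S)` clopen. -/
def compactOpenBisections : Set (Set (Arr (GroupoidP S))) :=
  {W | ∃ (g : LeftInverseHull S) (C : Set (Omega S)), IsClopen C ∧ W = bisection g ∩ source ⁻¹' C}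

theorem isCompact_of_mem_compactOpenBisections {W : Set (Arr (GroupoidP S))}
    (hW : W ∈ compactOpenBisections S) : IsCompact W := by
  obtain ⟨g, C, hC, rfl⟩ := hW
  exact (isCompact_bisection g).inter_right (hC.1.preimage continuous_source)

theorem exists_mem_bisection (γ : Arr (GroupoidP S)) : ∃ g, γ ∈ bisection g := by
  obtain ⟨x, y, ⟨k⟩⟩ := γ
  exact ⟨k.1, (mk_mem_bisection_iff k k.1).2 (.refl _)⟩

theorem isTopologicalBasis_compactOpenBisections :
    TopologicalSpace.IsTopologicalBasis (compactOpenBisections S) := by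
  refine TopologicalSpace.isTopologicalBasis_of_isOpen_of_nhds ?_ fun γ V hγ hV => ?_
  · rintro _ ⟨g, C, hC, rfl⟩
    exact (isOpen_bisection g).inter (hC.2.preimage continuous_source)
  · obtain ⟨g, hg⟩ := exists_mem_bisection γ
    obtain ⟨O, hO, hOV⟩ := hV.preimage (continuous_germArr g)
    have hmem : ∀ δ ∈ bisection g, source δ ∈ O ↔ δ ∈ V := fun δ hδ => by
      refine (Set.ext_iff.1 hOV ⟨source δ, hδ.1⟩).trans ?_
      rw [Set.mem_preimage, germArr_source hδ]
    obtain ⟨C, hC, hγC, hCO⟩ := compact_exists_isClopen_in_isOpen hO ((hmem γ hg).2 hγ)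
    exact ⟨_, ⟨g, C, hC, rfl⟩, ⟨hg, hγC⟩, fun δ hδ => (hmem δ hδ.1).1 (hCO hδ.2)⟩

theorem exists_sourcePullback_eq_indicator {g : LeftInverseHull S} {C : Set (Omega S)}
    (hC : IsClopen C) {f : Arr (GroupoidP S) → ℂ}
    (hf : ContinuousOn f (bisection g ∩ source ⁻¹' C)) :
    ∃ φ, (sourcePullback g φ).1 = (bisection g ∩ source ⁻¹' C).indicator f := by
  let F : C(↥(domSet g ∩ C), ℂ) :=
    ⟨fun χ => f (germArr g ⟨χ.1, χ.2.1⟩), hf.comp_continuous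
      ((continuous_germArr g).comp (continuous_subtype_val.subtype_mk _)) fun χ =>
        ⟨range_germArr g ▸ Set.mem_range_self _, χ.2.2⟩⟩
  obtain ⟨ψ, hψ⟩ := ContinuousMap.exists_restrict_eq ((isClosed_domSet g).inter hC.1) F
  refine ⟨⟨C.indicator ψ, ψ.continuous.indicator fun χ hχ => ?_⟩, ?_⟩
  · exact absurd hχ (hC.frontier_eq ▸ Set.notMem_empty χ)
  · change (bisection g).indicator ((source ⁻¹' C).indicator (ψ ∘ source)) = _
    rw [Set.indicator_indicator]
    refine Set.indicator_congr fun γ hγ => ?_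
    refine (DFunLike.congr_fun hψ ⟨source γ, hγ.1.1, hγ.2⟩).trans ?_
    exact congrArg f (germArr_source hγ.1)

theorem regRep_mem_closure (f : Cc (GroupoidP S)) :
    regRep f ∈ (indicatorSpan S).topologicalClosure := by
  let M : Submodule ℂ (Arr (GroupoidP S) → ℂ) := ((indicatorSpan S).topologicalClosure.comap
    (regRepLinear (GroupoidP S))).map (Cc (GroupoidP S)).subtype
  suffices hle : Cc (GroupoidP S) ≤ M by
    obtain ⟨f', hf', heq⟩ := hle f.2
    exact Subtype.ext heq ▸ hf'
  refine Submodule.span_le.2 ?_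
  rintro f ⟨V, hV, hT2, hf, K, hKV, hK, hsupp⟩
  refine mem_of_continuousOn_of_compact_support (M := M.toAddSubmonoid)
    isTopologicalBasis_compactOpenBisections (fun _ => isCompact_of_mem_compactOpenBisections) hV
    ?_ hK hKV hf hsupp
  rintro _ ⟨g, C, hC, rfl⟩ hWV f hf
  obtain ⟨φ, hφ⟩ := exists_sourcePullback_eq_indicator hC (hf.mono hWV)
  exact ⟨sourcePullback g φ, regRep_sourcePullback_mem_closure g φ, hφ⟩

end GroupoidP

end Density

section BisectionAlgebra

variable {S : Type*} [Monoid S] [IsLeftCancelMul S]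

open LeftInverseHull SemiChar

namespace GroupoidP

variable {x : GroupoidP S}

/-- The arrow `[g, x]` as an element of the source fiber of `x`. -/
def fiberGerm (g : LeftInverseHull S) (hg : x.1 (Idem.dom g) = true) : SourceFiber x :=
  ⟨⟨translate g x.1 hg, translate_mem_Omega hg x.2⟩,
    Quotient.mk (germSetoid x.1 (translate g x.1 hg)) ⟨g, hg, fun _ => rfl⟩⟩

theorem sourceFiber_mk_eq_iff {y z : GroupoidP S} {g : PreHom x.1 y.1} {h : PreHom x.1 z.1} :
    (⟨y, Quotient.mk (germSetoid x.1 y.1) g⟩ : SourceFiber x) =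
      ⟨z, Quotient.mk (germSetoid x.1 z.1) h⟩ ↔ GermEq x.1 g.1 h.1 := by
  refine ⟨fun heq => ?_, fun H => ?_⟩
  · obtain ⟨rfl, hgh⟩ := Sigma.mk.inj_iff.1 heq
    exact mk_eq_mk_iff.1 (eq_of_heq hgh)
  · obtain ⟨ψ, hψ⟩ := y
    obtain ⟨ω, hω⟩ := z
    obtain rfl : ψ = ω := SemiChar.ext <| funext fun p =>
      (g.2.2 p).trans ((H.map_conj p).trans (h.2.2 p).symm)
    exact congrArg (Sigma.mk _) (mk_eq_mk_iff.2 H)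

theorem mk_eq_fiberGerm {y : GroupoidP S} (g : PreHom x.1 y.1) :
    (⟨y, Quotient.mk (germSetoid x.1 y.1) g⟩ : SourceFiber x) = fiberGerm g.1 g.2.1 :=
  sourceFiber_mk_eq_iff.2 (.refl _)

theorem exists_fiberGerm_eq (k : SourceFiber x) : ∃ g hg, fiberGerm g hg = k := by
  obtain ⟨y, ⟨g⟩⟩ := k
  exact ⟨g.1, g.2.1, (mk_eq_fiberGerm g).symm⟩

theorem fiberGerm_eq_iff {g h : LeftInverseHull S} {hg : x.1 (Idem.dom g) = true}
    {hh : x.1 (Idem.dom h) = true} : fiberGerm g hg = fiberGerm h hh ↔ GermEq x.1 g h :=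
  sourceFiber_mk_eq_iff

open scoped Classical in
theorem entry_rho_bisectionIndicator (g : LeftInverseHull S) {h k : LeftInverseHull S}
    (hh : x.1 (Idem.dom h) = true) (hk : x.1 (Idem.dom k) = true) :
    EllTwo.entry (rho x (bisectionIndicator g)) (fiberGerm h hh) (fiberGerm k hk) =
      if GermEq x.1 (g * h) k then 1 else 0 := by
  rw [entry_rho]
  let h' : PreHom x.1 (fiberGerm h hh).1.1 := ⟨h, hh, fun _ => rfl⟩
  let k' : PreHom x.1 (fiberGerm k hk).1.1 := ⟨k, hk, fun _ => rfl⟩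
  refine (Set.indicator_apply _ _ _).trans (if_congr ?_ rfl rfl)
  refine (mk_mem_bisection_iff (h'.inv.comp k') g).trans ?_
  exact GermEq.mul_inv_iff h'

variable (x) in
open scoped Classical in
/-- The basis vector of `ℓ²(𝒢_x)` at `[g, x]`, or zero if `[g, x]` is undefined. -/
def germVector (g : LeftInverseHull S) : EllTwo (SourceFiber x) :=
  if hg : x.1 (Idem.dom g) = true then EllTwo.basisVector (fiberGerm g hg) else 0

open scoped Classical in
theorem germVector_apply (g : LeftInverseHull S) {h : LeftInverseHull S}
    (hh : x.1 (Idem.dom h) = true) :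
    germVector x g (fiberGerm h hh) = if GermEq x.1 g h then 1 else 0 := by
  rw [germVector]
  split_ifs with hg H H
  · rw [EllTwo.basisVector_apply, if_pos (fiberGerm_eq_iff.2 H.symm)]
  · rw [EllTwo.basisVector_apply, if_neg fun heq => H (fiberGerm_eq_iff.1 heq).symm]
  · exact absurd (H.map_dom.trans hh) hg
  · rfl

theorem rho_bisectionIndicator_germVector (g h : LeftInverseHull S) :
    rho x (bisectionIndicator g) (germVector x h) = germVector x (g * h) := by
  classical
  refine lp.ext (funext fun l => ?_)
  obtain ⟨k, hk, rfl⟩ := exists_fiberGerm_eq l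
  rw [germVector_apply, germVector]
  split_ifs with hh H H
  · exact (entry_rho_bisectionIndicator g hh hk).trans (if_pos H)
  · exact (entry_rho_bisectionIndicator g hh hk).trans (if_neg H)
  · exact absurd (x.1.mono (Idem.ideal_dom_mul_subset g h) (H.map_dom.trans hk)) hh
  · rw [map_zero]; rfl

theorem rho_bisectionIndicator_mul (g h : LeftInverseHull S) :
    rho x (bisectionIndicator g) * rho x (bisectionIndicator h) =
      rho x (bisectionIndicator (g * h)) := by
  have hvec : ∀ k, (rho x (bisectionIndicator g) * rho x (bisectionIndicator h)) (germVector x k) =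
      rho x (bisectionIndicator (g * h)) (germVector x k) := fun k => by
    simp only [mul_apply_eq_comp, rho_bisectionIndicator_germVector, mul_assoc]
  refine EllTwo.ext_entry fun i j => ?_
  obtain ⟨k, hk, rfl⟩ := exists_fiberGerm_eq i
  have hk' : germVector x k = EllTwo.basisVector (fiberGerm k hk) := dif_pos hk
  rw [EllTwo.entry, EllTwo.entry, ← hk', hvec]

theorem star_rho_bisectionIndicator (g : LeftInverseHull S) :
    star (rho x (bisectionIndicator g)) = rho x (bisectionIndicator g⁻¹) := by
  classical
  refine EllTwo.ext_entry fun i j => ?_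
  obtain ⟨k, hk, rfl⟩ := exists_fiberGerm_eq i
  obtain ⟨l, hl, rfl⟩ := exists_fiberGerm_eq j
  rw [entry_rho_bisectionIndicator]
  refine (EllTwo.entry_adjoint _ _ _).trans ?_
  rw [entry_rho_bisectionIndicator, apply_ite (starRingEnd ℂ), _root_.map_one, map_zero]
  exact if_congr (GermEq.mul_iff_inv_mul hl hk) rfl rfl

theorem regRep_bisectionIndicator_mul (g h : LeftInverseHull S) :
    regRep (bisectionIndicator g) * regRep (bisectionIndicator h) =
      regRep (bisectionIndicator (g * h)) :=
  BoundedFamilies.ext_eval fun _ => rho_bisectionIndicator_mul g h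

theorem star_regRep_bisectionIndicator (g : LeftInverseHull S) :
    star (regRep (bisectionIndicator g)) = regRep (bisectionIndicator g⁻¹) :=
  BoundedFamilies.ext_eval fun _ => star_rho_bisectionIndicator g

variable (S) in
/-- The operator families `(ρ_χ(1_B))_χ`, `B` ranging over the bisections of the `g ∈ I_ℓ(S)`. -/
def indicatorSubsemigroup : Subsemigroup (ProdB (GroupoidP S)) where
  carrier := Set.range fun g => regRep (bisectionIndicator g)
  mul_mem' := by
    rintro _ _ ⟨g, rfl⟩ ⟨h, rfl⟩
    exact ⟨g * h, (regRep_bisectionIndicator_mul g h).symm⟩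

variable (S) in
/-- The `*`-algebra generated by the operator families `(ρ_χ(1_B))_χ`, `B` ranging over the
bisections of the `g ∈ I_ℓ(S)`. -/
def indicatorAlgebra : NonUnitalStarSubalgebra ℂ (ProdB (GroupoidP S)) :=
  NonUnitalStarAlgebra.adjoin ℂ (Set.range fun g => regRep (bisectionIndicator g))

theorem coe_indicatorAlgebra :
    (indicatorAlgebra S : Set (ProdB (GroupoidP S))) = indicatorSpan S := by
  have hstar : star (Set.range fun g : LeftInverseHull S => regRep (bisectionIndicator g)) =
      Set.range fun g => regRep (bisectionIndicator g) := by
    rw [← Set.image_star, ← Set.range_comp]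
    refine (congrArg Set.range (funext star_regRep_bisectionIndicator)).trans ?_
    exact (inv_involutive (G := LeftInverseHull S)).surjective.range_comp
      fun g => regRep (bisectionIndicator g)
  have := NonUnitalStarAlgebra.adjoin_eq_span (R := ℂ)
    (Set.range fun g : LeftInverseHull S => regRep (bisectionIndicator g))
  rw [hstar, Set.union_self] at this
  exact congrArg SetLike.coe (this.trans
    (congrArg (fun s : Subsemigroup _ => Submodule.span ℂ (s : Set (ProdB (GroupoidP S))))
      (indicatorSubsemigroup S).closure_eq))

theorem reducedCStar_le :
    reducedCStar (GroupoidP S) ≤ (indicatorAlgebra S).topologicalClosure := by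
  refine NonUnitalStarSubalgebra.topologicalClosure_minimal _ (NonUnitalStarAlgebra.adjoin_le ?_)
    (NonUnitalStarSubalgebra.isClosed_topologicalClosure _)
  rintro _ ⟨f, rfl⟩
  change regRep f ∈ closure (indicatorAlgebra S : Set (ProdB (GroupoidP S)))
  rw [coe_indicatorAlgebra]
  exact regRep_mem_closure f

end GroupoidP

end BisectionAlgebra

section NormComparison

variable {S : Type*} [Monoid S] [IsLeftCancelMul S]

open LeftInverseHull SemiChar

namespace GroupoidP

theorem toFiber_eq_fiberGerm (s : S) :
    toFiber s = fiberGerm (x := chiE S) (of s) (point_dom_of s) :=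
  mk_eq_fiberGerm (x := chiE S) (y := (toFiber s).1) ⟨of s, point_dom_of s, translation_conj s⟩

open scoped Classical in
theorem entry_rho_chiE_bisectionIndicator (g : LeftInverseHull S) (s t : S) :
    EllTwo.entry (rho (chiE S) (bisectionIndicator g)) (toFiber s) (toFiber t) =
      if g.1 s = some t then 1 else 0 := by
  rw [toFiber_eq_fiberGerm, toFiber_eq_fiberGerm]
  refine (entry_rho_bisectionIndicator g (point_dom_of s) (point_dom_of t)).trans ?_
  refine if_congr (germEq_point_one_of_iff.trans (Eq.congr_left ?_)) rfl rfl
  change g.1 (s * 1) = g.1 s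
  rw [mul_one]

theorem entry_eval_sum (x : GroupoidP S) (c : LeftInverseHull S →₀ ℂ) (k l : SourceFiber x) :
    EllTwo.entry (BoundedFamilies.eval x
        (c.sum fun g z => z • regRep (bisectionIndicator g))) k l =
      c.sum fun g z => z * EllTwo.entry (rho x (bisectionIndicator g)) k l := by
  let entryMap : ProdB (GroupoidP S) →+ ℂ :=
    { toFun := fun a => EllTwo.entry (BoundedFamilies.eval x a) k l
      map_zero' := rfl
      map_add' := fun _ _ => rfl }
  exact map_finsuppSum entryMap c _

theorem exists_realization (hS : StronglyCStarRegular S) (x : GroupoidP S)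
    (G : Finset (LeftInverseHull S)) (t : Finset (SourceFiber x)) :
    ∃ u : SourceFiber x → S, Set.InjOn u t ∧ ∀ g ∈ G, ∀ k ∈ t, ∀ l ∈ t,
      EllTwo.entry (rho x (bisectionIndicator g)) k l =
        EllTwo.entry (rho (chiE S) (bisectionIndicator g)) (toFiber (u k)) (toFiber (u l)) := by
  classical
  choose rep hdom hrep using exists_fiberGerm_eq (x := x)
  obtain ⟨s, hs⟩ := hS.exists_separating x.2
    ((insert 1 G ×ˢ t ×ˢ t).image fun y => (y.1 * rep y.2.1, rep y.2.2)) <|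
      Finset.forall_mem_image.2 fun y _ => hdom y.2.2
  have hsep : ∀ g ∈ insert 1 G, ∀ k ∈ t, ∀ l ∈ t, s ∈ (Idem.dom (rep l)).ideal ∧
      ((g * rep k).1 s = (rep l).1 s ↔ GermEq x.1 (g * rep k) (rep l)) := fun g hg k hk l hl =>
    hs _ (Finset.mem_image_of_mem _ (Finset.mk_mem_product hg (Finset.mk_mem_product hk hl)))
  have hone : (1 : LeftInverseHull S) ∈ insert 1 G := Finset.mem_insert_self 1 G
  have hval : ∀ k, ∃ u, k ∈ t → (rep k).1 s = some u := fun k => by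
    by_cases hk : k ∈ t
    · exact (Idem.mem_ideal_dom.1 (hsep 1 hone k hk k hk).1).imp fun u hu _ => hu
    · exact ⟨1, fun hk' => absurd hk' hk⟩
  choose u hu using hval
  refine ⟨u, fun k hk l hl hkl => ?_, fun g hg k hk l hl => ?_⟩
  · have := (hsep 1 hone k hk l hl).2.1 (by rw [one_mul, hu k hk, hu l hl, hkl])
    rw [one_mul] at this
    rw [← hrep k, ← hrep l, fiberGerm_eq_iff.2 this]
  · have hgerm := (hsep g (Finset.mem_insert_of_mem hg) k hk l hl).2
    rw [mul_apply, hu k hk, hu l hl, Option.bind_some] at hgerm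
    rw [entry_rho_chiE_bisectionIndicator, ← if_congr hgerm.symm rfl rfl,
      ← entry_rho_bisectionIndicator g (hdom k) (hdom l), hrep, hrep]

theorem norm_eval_le_of_mem_indicatorSpan (hS : StronglyCStarRegular S)
    {a : ProdB (GroupoidP S)} (ha : a ∈ indicatorSpan S) (x : GroupoidP S) :
    ‖BoundedFamilies.eval x a‖ ≤ ‖BoundedFamilies.eval (chiE S) a‖ := by
  obtain ⟨c, rfl⟩ := Finsupp.mem_span_range_iff_exists_finsupp.1 ha
  refine EllTwo.opNorm_le_of_forall_block _ _ fun t => ?_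
  obtain ⟨u, hinj, hu⟩ := exists_realization hS x c.support t
  refine ⟨fun k => toFiber (u k), toFiber_bijective.injective.comp_injOn hinj,
    fun k hk l hl => ?_⟩
  rw [entry_eval_sum, entry_eval_sum]
  exact Finsupp.sum_congr fun g hg => congrArg (c g * ·) (hu g hg k hk l hl)

theorem norm_eval_chiE (hS : StronglyCStarRegular S) {a : ProdB (GroupoidP S)}
    (ha : a ∈ reducedCStar (GroupoidP S)) : ‖BoundedFamilies.eval (chiE S) a‖ = ‖a‖ := by
  refine le_antisymm (BoundedFamilies.norm_eval_le _ a)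
    (BoundedFamilies.norm_le (norm_nonneg _) fun x => ?_)
  have hclosed : IsClosed {b : ProdB (GroupoidP S) |
      ‖BoundedFamilies.eval x b‖ ≤ ‖BoundedFamilies.eval (chiE S) b‖} :=
    isClosed_le (BoundedFamilies.continuous_eval x).norm
      (BoundedFamilies.continuous_eval (chiE S)).norm
  refine hclosed.closure_subset_iff.2 (fun b hb => ?_) (reducedCStar_le ha)
  exact norm_eval_le_of_mem_indicatorSpan hS (coe_indicatorAlgebra.subset hb) x

end GroupoidP

end NormComparison

section Image

variable {S : Type*} [Monoid S] [IsLeftCancelMul S]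

open LeftInverseHull

namespace GroupoidP

/-- The representation `ρ_{χ_e}` on `ℓ²(S)`, as the evaluation of operator families at `χ_e`. -/
def rhoE : ProdB (GroupoidP S) →⋆ₙₐ[ℂ] (EllTwo S →L[ℂ] EllTwo S) :=
  ((EllTwo.reindex (fiberEquiv S)).symm.conjStarAlgEquiv :
    (EllTwo (SourceFiber (chiE S)) →L[ℂ] EllTwo (SourceFiber (chiE S))) →⋆ₙₐ[ℂ]
      (EllTwo S →L[ℂ] EllTwo S)).comp (BoundedFamilies.eval (chiE S))

theorem norm_rhoE (a : ProdB (GroupoidP S)) : ‖rhoE a‖ = ‖BoundedFamilies.eval (chiE S) a‖ :=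
  StarAlgEquiv.norm_map (EllTwo.reindex (fiberEquiv S)).symm.conjStarAlgEquiv _

open scoped CStarAlgebra in
theorem continuous_rhoE : Continuous (rhoE (S := S)) :=
  map_continuous _

theorem rhoE_regRep_of (s : S) : rhoE (regRep (bisectionIndicator (of s))) = leftRegular s := by
  classical
  refine EllTwo.ext_entry fun u t => ?_
  refine (EllTwo.entry_conj_reindex (fiberEquiv S).symm _ u t).trans ?_
  refine (entry_rho_chiE_bisectionIndicator (of s) u t).trans ?_
  have hbasis : leftRegular s (EllTwo.basisVector u) = EllTwo.basisVector (s * u) :=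
    leftRegular_single s u
  rw [EllTwo.entry, hbasis, EllTwo.basisVector_apply]
  exact if_congr (Option.some_inj.trans eq_comm) rfl rfl

theorem rhoE_regRep_bisectionIndicator_mem (g : LeftInverseHull S) :
    rhoE (regRep (bisectionIndicator g)) ∈ monoidReducedCStar S := by
  obtain ⟨f, hf⟩ := g
  induction hf with
  | translation s =>
    refine (rhoE_regRep_of s).symm ▸ NonUnitalStarSubalgebra.le_topologicalClosure _ ?_
    exact NonUnitalStarAlgebra.subset_adjoin ℂ _ ⟨s, rfl⟩
  | symm hf ih =>
    have := star_mem ih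
    rwa [← map_star, star_regRep_bisectionIndicator] at this
  | trans hf hf' ih ih' =>
    have := mul_mem ih' ih
    rwa [← map_mul, regRep_bisectionIndicator_mul] at this

theorem rhoE_mem {a : ProdB (GroupoidP S)} (ha : a ∈ reducedCStar (GroupoidP S)) :
    rhoE a ∈ monoidReducedCStar S := by
  have hle : (indicatorAlgebra S).topologicalClosure ≤
      NonUnitalStarSubalgebra.comap rhoE (monoidReducedCStar S) := by
    refine NonUnitalStarSubalgebra.topologicalClosure_minimal _
      (NonUnitalStarAlgebra.adjoin_le ?_)
      ((NonUnitalStarSubalgebra.isClosed_topologicalClosure _).preimage continuous_rhoE)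
    rintro _ ⟨g, rfl⟩
    exact rhoE_regRep_bisectionIndicator_mem g
  exact hle (reducedCStar_le ha)

variable (S) in
/-- The representation `ρ_{χ_e}` of `C*_r(𝒢_P(S))` on `ℓ²(S)`. -/
def reducedRhoE : reducedCStar (GroupoidP S) →⋆ₙₐ[ℂ] (EllTwo S →L[ℂ] EllTwo S) :=
  rhoE.comp (NonUnitalStarSubalgebraClass.subtype (reducedCStar (GroupoidP S)))

theorem isometry_reducedRhoE (hS : StronglyCStarRegular S) : Isometry (reducedRhoE S) :=
  AddMonoidHomClass.isometry_of_norm _ fun a => (norm_rhoE a.1).trans (norm_eval_chiE hS a.2)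

theorem monoidReducedCStar_le_range (hS : StronglyCStarRegular S) :
    monoidReducedCStar S ≤ NonUnitalStarAlgHom.range (reducedRhoE S) := by
  have : CompleteSpace (reducedCStar (GroupoidP S)) :=
    (NonUnitalStarSubalgebra.isClosed_topologicalClosure _).completeSpace_coe
  refine NonUnitalStarSubalgebra.topologicalClosure_minimal _ (NonUnitalStarAlgebra.adjoin_le ?_)
    (isometry_reducedRhoE hS).isClosedEmbedding.isClosed_range
  rintro _ ⟨s, rfl⟩
  exact ⟨⟨regRep (bisectionIndicator (of s)), NonUnitalStarSubalgebra.le_topologicalClosure _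
    (NonUnitalStarAlgebra.subset_adjoin ℂ _ ⟨_, rfl⟩)⟩, rhoE_regRep_of s⟩

end GroupoidP

end Image

end

theorem proposition2p5 {S : Type*} [Monoid S] [IsLeftCancelMul S]
    (hS : StronglyCStarRegular S) :
    ∃ Φ : reducedCStar (GroupoidP S) ≃⋆ₐ[ℂ] monoidReducedCStar S,
      ∀ a : reducedCStar (GroupoidP S),
        (Φ a : EllTwo S →L[ℂ] EllTwo S) =
          (EllTwo.reindex (fiberEquiv S)).symm.conjStarAlgEquiv (reducedRho (chiE S) a) := by
  let φ := NonUnitalStarAlgHom.codRestrict (GroupoidP.reducedRhoE S) (monoidReducedCStar S)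
    fun a => GroupoidP.rhoE_mem a.2
  refine ⟨StarAlgEquiv.ofBijective φ ⟨fun a b h => ?_, fun y => ?_⟩, fun a => rfl⟩
  · exact (GroupoidP.isometry_reducedRhoE hS).injective (congrArg Subtype.val h)
  · obtain ⟨a, ha⟩ := GroupoidP.monoidReducedCStar_le_range hS y.2
    exact ⟨a, Subtype.ext ha⟩
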